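/- Let $n\ge 3$ and let $\rho_1,\dots,\rho_n\in(0,1)$ satisfy $\sum_{i=1}^n\rho_i<1$. Let $D\subset\mathbb R$ be any dust-like self-similar set with contraction vector $(\rho_1,\dots,\rho_n)$, that is, $D$ is the nonempty compact set satisfying $D=\bigcup_{i=1}^n\Phi_i(D)$, where $\Phi_i:\mathbb R\to\mathbb R$ is a similitude with ratio $\rho_i$ for each $i$ and $\Phi_i(D)\cap\Phi_j(D)=\emptyset$ for $i\ne j$. Let $\Psi_i(x)=\rho_i x+t_i$ $(1\le i\le n)$ be maps such that - the intervals $\Psi_1([0,1]),\dots,\Psi_n([0,1])$ are arranged from left to right and have pairwise disjoint interiors; - $\Psi_1(0)=0$ and $\Psi_n(1)=1$; - $\Psi_i(1)=\Psi_{i+1}(0)$ for at least one $i\in\{1,\dots,n-1\}$; and let $T$ be the nonempty compact set satisfying $T=\bigcup_{i=1}^n\Psi_i(T)$. Let $\Sigma_T=\{i\in\{1,\dots,n-1\}:\Psi_i(1)=\Psi_{i+1}(0)\}$ and $\Sigma_T+1=\{i+1:i\in\Sigma_T\}$. Let $\alpha$ and $\beta$ be the numbers of successive touching intervals at the beginning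 and at the end: $\alpha$ is the largest $k\in\{1,\dots,n\}$ such that $1,\dots,k-1\in\Sigma_T$, and $\beta$ is the largest $k\in\{1,\dots,n\}$ such that $n-k+1,\dots,n-1\in\Sigma_T$. Suppose that at least one of the following conditions holds: 1. $\log\rho_i/\log\rho_j\in\mathbb Q$ for all $i,j\in\{1,n,\alpha\}\cup(\Sigma_T+1)$; 2. $\log\rho_i/\log\rho_j\in\mathbb Q$ for all $i,j\in\{1,n,n-\beta+1\}\cup\Sigma_T$. Then $D\sim T$, i.e. $D$ and $T$ are Lipschitz equivalent: there are a bijection $f:D\to T$ and constants $c,c'>0$ with $c|x-y|\le|f(x)-f(y)|\le c'|x-y|$ for all $x,y\in D$. -/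

import Mathlib

/-- `E` and `F` are Lipschitz equivalent, `E ∼ F`: there is a bi-Lipschitz bijection `E → F`. -/
def LipschitzEquivalent (E F : Set ℝ) : Prop :=
  ∃ f : E → F, Function.Bijective f ∧ ∃ c c' : ℝ, 0 < c ∧ 0 < c' ∧
    ∀ x y : E, c * dist x y ≤ dist (f x) (f y) ∧ dist (f x) (f y) ≤ c' * dist x y

/-- `f` is a similitude of the line with ratio `r` (orientation reversing maps are allowed). -/
def IsSimilitude (r : ℝ) (f : ℝ → ℝ) : Prop :=
  ∀ x y : ℝ, dist (f x) (f y) = r * dist x y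

/-- `E` is the attractor of the IFS `f`: the nonempty compact set with `⋃ i, f i (E) = E`
(it is unique if the `f i` are contractions). -/
def IsAttractor {n : ℕ} (f : Fin n → ℝ → ℝ) (E : Set ℝ) : Prop :=
  E.Nonempty ∧ IsCompact E ∧ ⋃ i, f i '' E = E

/-- `ρ` is a (separable) contraction vector in `ℝ`. -/
def IsContractionVector {n : ℕ} (ρ : Fin n → ℝ) : Prop :=
  (∀ i, 0 < ρ i ∧ ρ i < 1) ∧ ∑ i, ρ i < 1

/-- `D` is a dust-like self-similar subset of `ℝ` with contraction vector `ρ`: the attractor of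
an IFS of similitudes with ratios `ρ i` that satisfies the strong separation condition. -/
def IsDustLike {n : ℕ} (ρ : Fin n → ℝ) (D : Set ℝ) : Prop :=
  ∃ Φ : Fin n → ℝ → ℝ, (∀ i, IsSimilitude (ρ i) (Φ i)) ∧ IsAttractor Φ D ∧
    ∀ i j, i ≠ j → Disjoint (Φ i '' D) (Φ j '' D)

/-- The map `Ψ_i (x) = ρ_i x + t_i`. -/
def affineIFS {n : ℕ} (ρ t : Fin n → ℝ) (i : Fin n) (x : ℝ) : ℝ := ρ i * x + t i

/-- The number, in `{1, …, n}`, of an index: the letters are numbered from `1`. -/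
def letter {n : ℕ} (i : Fin n) : ℕ := (i : ℕ) + 1

/-- `Σ_T`, the set of (left) touching letters, as a subset of `{1, …, n}`:
the `k` such that `Ψ_k (1) = Ψ_{k+1} (0)`. -/
def touchingLetters {n : ℕ} (ρ t : Fin n → ℝ) : Set ℕ :=
  {k | ∃ i j : Fin n, letter i = k ∧ letter j = k + 1 ∧ affineIFS ρ t i 1 = affineIFS ρ t j 0}

/-- `α`, the number of successive touching intervals at the beginning: the number of letters `k`
such that each of the intervals number `1, …, k - 1` touches the next one. -/
noncomputable def alphaT {n : ℕ} (ρ t : Fin n → ℝ) : ℕ :=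
  {k : ℕ | 1 ≤ k ∧ k ≤ n ∧ ∀ l, 1 ≤ l → l < k → l ∈ touchingLetters ρ t}.ncard

/-- `β`, the number of successive touching intervals at the end: the number of letters `k`
such that each of the intervals number `k, …, n - 1` touches the next one. -/
noncomputable def betaT {n : ℕ} (ρ t : Fin n → ℝ) : ℕ :=
  {k : ℕ | 1 ≤ k ∧ k ≤ n ∧ ∀ l, k ≤ l → l < n → l ∈ touchingLetters ρ t}.ncard

/-- The standing assumptions on the IFS `Ψ_i (x) = ρ_i x + t_i`. -/
structure IsTouchingIFS {n : ℕ} (ρ t : Fin n → ℝ) : Prop where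
  /-- The intervals `Ψ_i [0, 1] = [Ψ_i (0), Ψ_i (1)]` are arranged from left to right, and their
  interiors do not intersect. -/
  ordered : ∀ i j : Fin n, i < j → affineIFS ρ t i 1 ≤ affineIFS ρ t j 0
  /-- The left endpoint of the first interval is `0`. -/
  left_end : ∀ i : Fin n, letter i = 1 → affineIFS ρ t i 0 = 0
  /-- The right endpoint of the last interval is `1`. -/
  right_end : ∀ i : Fin n, letter i = n → affineIFS ρ t i 1 = 1
  /-- At least two consecutive intervals touch. -/
  touching : (touchingLetters ρ t).Nonempty

/-- `log ρ_i / log ρ_j` is rational for all letters `i`, `j` in `S`. -/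
def RationalLogRatios {n : ℕ} (ρ : Fin n → ℝ) (S : Set ℕ) : Prop :=
  ∀ i j : Fin n, letter i ∈ S → letter j ∈ S →
    ∃ q : ℚ, Real.log (ρ i) / Real.log (ρ j) = (q : ℝ)

/-! Both sets are compared with the space of infinite words on `n` letters, where two words are as
far apart as the ratio of their longest common prefix. If the cylinders of a family of maps have
diameters bounded by a multiple of the ratios of their words, and sibling cylinders are separated at
the scale of their parent, then the set is bi-Lipschitz to that space
(`GeneratesAtScale.exists_coding`). For `D` the given similitudes do this. For `T` they fail at the
touching points, and the `Ψ j` are replaced by rewired maps `H j` with the same ratios.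

Let `o` and `l` be the first and last letters, `a` a letter followed by a gap, and `Z` the part of
`T` to the right of that gap. At a touching pair `i`, `suc i`, write words for the corresponding
cylinder maps. The copy `i l^c Z`, which ends at the touching point, must leave the image of `i`; it
goes to a copy `(suc i) J Z` of the same size inside the right interval. Moving the old content of
that copy back in one block would send two points of the right interval to the touching point.
Instead it is distributed along a chain: `(suc i) o^{pk} J Z` splits into an inner copy `l^q Z`,
which moves to level `k + 1`, and a shell, which moves to the `k`-th shell of `i l^c Z`. All sizes
match because `ρ_o^p = ρ_l^q` and `ρ_{suc i} R(J) = ρ_i ρ_l^c`. The word `J` contains one extra `i`,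
so `ρ_i` cancels and only the ratios of `suc i`, `o`, `a`, `l` need to be commensurable.

Each `H j` is a similarity on every piece, and the pieces are isolated by gaps comparable to their
displacement, so `H j` is bi-Lipschitz (`exists_biLip_H`). Constants do not accumulate under
composition (`exists_biLip_Hw`): the rewired maps agree with the original ones along the words of
the pieces, so a cylinder is cut by a piece only if its word is a prefix of a piece's word followed
by one letter, and such words are bounded apart from an initial run of `o`.

Taking `a` at the first gap gives the case of condition 1; the reflection `x ↦ 1 - x` gives that of
condition 2. -/

open Filter Topology

/-! ### Words and their ratios -/

/-- The composition `H w₀ ∘ H w₁ ∘ ⋯` of a family of maps along a word `w`. -/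
def wordMap {ι : Type*} (H : ι → ℝ → ℝ) : List ι → ℝ → ℝ
  | [], x => x
  | j :: w, x => H j (wordMap H w x)

/-- The product of the ratios along a word. -/
def wordRatio {ι : Type*} (ρ : ι → ℝ) (w : List ι) : ℝ := (w.map ρ).prod

section Words

variable {ι : Type*}

@[simp] theorem wordMap_nil (H : ι → ℝ → ℝ) (x : ℝ) : wordMap H [] x = x := rfl

@[simp] theorem wordMap_cons (H : ι → ℝ → ℝ) (j : ι) (w : List ι) (x : ℝ) :
    wordMap H (j :: w) x = H j (wordMap H w x) := rfl

theorem wordMap_append (H : ι → ℝ → ℝ) (u v : List ι) (x : ℝ) :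
    wordMap H (u ++ v) x = wordMap H u (wordMap H v x) := by
  induction u with
  | nil => rfl
  | cons j u ih => simp [ih]

@[simp] theorem wordRatio_nil (ρ : ι → ℝ) : wordRatio ρ [] = 1 := rfl

@[simp] theorem wordRatio_cons (ρ : ι → ℝ) (j : ι) (w : List ι) :
    wordRatio ρ (j :: w) = ρ j * wordRatio ρ w := by simp [wordRatio]

@[simp] theorem wordRatio_append (ρ : ι → ℝ) (u v : List ι) :
    wordRatio ρ (u ++ v) = wordRatio ρ u * wordRatio ρ v := by simp [wordRatio]

@[simp] theorem wordRatio_replicate (ρ : ι → ℝ) (m : ℕ) (j : ι) :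
    wordRatio ρ (List.replicate m j) = ρ j ^ m := by simp [wordRatio]

theorem wordRatio_pos {ρ : ι → ℝ} (h : ∀ i, 0 < ρ i) (w : List ι) : 0 < wordRatio ρ w := by
  induction w with
  | nil => simp
  | cons j w ih => simpa using mul_pos (h j) ih

theorem wordRatio_le_pow {ρ : ι → ℝ} (h : ∀ i, 0 < ρ i) {r : ℝ} (hr : ∀ i, ρ i ≤ r)
    (w : List ι) : wordRatio ρ w ≤ r ^ w.length := by
  induction w with
  | nil => simp
  | cons j w ih =>
    rw [wordRatio_cons, List.length_cons, pow_succ']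
    exact mul_le_mul (hr j) ih (wordRatio_pos h w).le ((h j).le.trans (hr j))

theorem wordRatio_le_one {ρ : ι → ℝ} (h : ∀ i, 0 < ρ i) (h1 : ∀ i, ρ i < 1)
    (w : List ι) : wordRatio ρ w ≤ 1 := by
  simpa using wordRatio_le_pow h (fun i => (h1 i).le) w

theorem wordMap_mem {H : ι → ℝ → ℝ} {E : Set ℝ} (h : ∀ j, ∀ x ∈ E, H j x ∈ E) (w : List ι)
    {x : ℝ} (hx : x ∈ E) : wordMap H w x ∈ E := by
  induction w with
  | nil => exact hx
  | cons j w ih => exact h j _ ih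

end Words

/-! ### Coding by infinite words and Lipschitz equivalence -/

/-- The prefix of length `m` of an infinite word. -/
def pref {ι : Type*} (ω : ℕ → ι) (m : ℕ) : List ι := (List.range m).map ω

section Coding

variable {n : ℕ}

theorem pref_succ (ω : ℕ → Fin n) (m : ℕ) : pref ω (m + 1) = pref ω m ++ [ω m] := by
  simp [pref, List.range_succ]

theorem pref_length (ω : ℕ → Fin n) (m : ℕ) : (pref ω m).length = m := by simp [pref]

theorem pref_congr {ω ω' : ℕ → Fin n} {m : ℕ} (h : ∀ k < m, ω k = ω' k) :
    pref ω m = pref ω' m := by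
  simp only [pref]
  exact List.map_congr_left (fun k hk => h k (List.mem_range.1 hk))

/-- The family `H` generates `E` by pieces `H_w (E)` of diameter comparable to the ratio of `w`,
such that pieces with the same parent are separated at the scale of the parent. -/
structure GeneratesAtScale (ρ : Fin n → ℝ) (E : Set ℝ) (H : Fin n → ℝ → ℝ) (c C : ℝ) : Prop where
  compact : IsCompact E
  nonempty : E.Nonempty
  mem : ∀ j, ∀ x ∈ E, H j x ∈ E
  cover : ∀ x ∈ E, ∃ j, ∃ y ∈ E, H j y = x
  upper : ∀ w, ∀ x ∈ E, ∀ y ∈ E, |wordMap H w x - wordMap H w y| ≤ C * wordRatio ρ w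
  lower : ∀ w, ∀ i j, i ≠ j → ∀ x ∈ E, ∀ y ∈ E,
    c * wordRatio ρ w ≤ |wordMap H w (H i x) - wordMap H w (H j y)|

theorem exists_uniform_ratio {ρ : Fin n → ℝ} (h0 : ∀ i, 0 < ρ i) (h1 : ∀ i, ρ i < 1) :
    ∃ r, 0 ≤ r ∧ r < 1 ∧ ∀ i, ρ i ≤ r := by
  rcases isEmpty_or_nonempty (Fin n) with he | he
  · exact ⟨0, le_rfl, one_pos, fun i => he.elim i⟩
  · obtain ⟨i, hi⟩ := Finite.exists_max ρ
    exact ⟨ρ i, (h0 i).le, h1 i, hi⟩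

theorem tendsto_wordRatio_pref {ρ : Fin n → ℝ} (h0 : ∀ i, 0 < ρ i) (h1 : ∀ i, ρ i < 1)
    (ω : ℕ → Fin n) : Tendsto (fun m => wordRatio ρ (pref ω m)) atTop (𝓝 0) := by
  obtain ⟨r, hr0, hr1, hr⟩ := exists_uniform_ratio h0 h1
  refine squeeze_zero (fun m => (wordRatio_pos h0 _).le) (fun m => ?_)
    (tendsto_pow_atTop_nhds_zero_of_lt_one hr0 hr1)
  simpa [pref_length] using wordRatio_le_pow h0 hr (pref ω m)

theorem pref_add (ω : ℕ → Fin n) (m k : ℕ) :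
    pref ω (m + k) = pref ω m ++ pref (fun i => ω (m + i)) k := by
  induction k with
  | zero => simp [pref]
  | succ k ih => rw [← add_assoc, pref_succ, ih, pref_succ, List.append_assoc]

/-- A family generating `E` at scale yields a bijective coding of `E` by infinite words. -/
theorem GeneratesAtScale.exists_coding {ρ : Fin n → ℝ} {E : Set ℝ} {H : Fin n → ℝ → ℝ} {c C : ℝ}
    (h0 : ∀ i, 0 < ρ i) (h1 : ∀ i, ρ i < 1) (hG : GeneratesAtScale ρ E H c C) :
    ∃ π : (ℕ → Fin n) → ℝ, (∀ ω, π ω ∈ E) ∧ (∀ x ∈ E, ∃ ω, π ω = x) ∧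
      ∀ ω ω' m, (∀ k < m, ω k = ω' k) → ω m ≠ ω' m →
        c * wordRatio ρ (pref ω m) ≤ |π ω - π ω'| ∧
        |π ω - π ω'| ≤ C * wordRatio ρ (pref ω m) := by
  obtain ⟨x₀, hx₀⟩ := hG.nonempty
  have hmem : ∀ w, ∀ x ∈ E, wordMap H w x ∈ E := fun w x hx => wordMap_mem hG.mem w hx
  have hlim : ∀ ω : ℕ → Fin n, ∃ y ∈ E,
      Tendsto (fun m => wordMap H (pref ω m) x₀) atTop (𝓝 y) := by
    intro ω
    have hC : Tendsto (fun m => C * wordRatio ρ (pref ω m)) atTop (𝓝 0) := by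
      simpa using (tendsto_wordRatio_pref h0 h1 ω).const_mul C
    have hcau : CauchySeq (fun m => wordMap H (pref ω m) x₀) := by
      refine cauchySeq_of_le_tendsto_0' _ (fun m k hmk => ?_) hC
      obtain ⟨k, rfl⟩ := Nat.exists_eq_add_of_le hmk
      rw [pref_add, wordMap_append, Real.dist_eq]
      exact hG.upper _ _ hx₀ _ (hmem _ _ hx₀)
    obtain ⟨y, hy⟩ := cauchySeq_tendsto_of_complete hcau
    exact ⟨y, hG.compact.isClosed.mem_of_tendsto hy
      (Eventually.of_forall fun m => hmem _ _ hx₀), hy⟩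
  choose π hπE hπ using hlim
  refine ⟨π, hπE, ?_, ?_⟩
  · intro x hx
    have : Nonempty (Fin n) := ⟨(hG.cover x hx).choose⟩
    choose! a b hb hab using hG.cover
    let X : ℕ → ℝ := fun m => b^[m] x
    have hX : ∀ m, X m ∈ E := fun m => by
      induction m with
      | zero => exact hx
      | succ m ih => simpa only [X, Function.iterate_succ_apply'] using hb _ ih
    let ω : ℕ → Fin n := fun m => a (X m)
    have hxm : ∀ m, wordMap H (pref ω m) (X m) = x := by
      intro m
      induction m with
      | zero => rfl
      | succ m ih =>
        rw [pref_succ, wordMap_append]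
        have : H (a (X m)) (X (m + 1)) = X m := by
          simpa only [X, Function.iterate_succ_apply'] using hab _ (hX m)
        simpa [ω, this] using ih
    refine ⟨ω, tendsto_nhds_unique (hπ ω) ?_⟩
    rw [tendsto_iff_dist_tendsto_zero]
    have hC : Tendsto (fun m => C * wordRatio ρ (pref ω m)) atTop (𝓝 0) := by
      simpa using (tendsto_wordRatio_pref h0 h1 ω).const_mul C
    refine squeeze_zero (fun _ => dist_nonneg) (fun m => ?_) hC
    have := hG.upper (pref ω m) x₀ hx₀ (X m) (hX m)
    rwa [hxm] at this
  · intro ω ω' m hlt hne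
    have htend := ((hπ ω).sub (hπ ω')).abs
    have hp : pref ω m = pref ω' m := pref_congr hlt
    -- Beyond the first difference both approximants lie in sibling cylinders of the common prefix,
    -- so the bounds for siblings pass to the limit.
    have key : ∀ M, m + 1 ≤ M → ∃ x ∈ E, ∃ y ∈ E,
        wordMap H (pref ω M) x₀ = wordMap H (pref ω m) (H (ω m) x) ∧
        wordMap H (pref ω' M) x₀ = wordMap H (pref ω m) (H (ω' m) y) := by
      intro M hM
      obtain ⟨k, rfl⟩ := Nat.exists_eq_add_of_le hM
      refine ⟨_, hmem (pref (fun i => ω (m + 1 + i)) k) x₀ hx₀,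
        _, hmem (pref (fun i => ω' (m + 1 + i)) k) x₀ hx₀, ?_, ?_⟩
      · simp [pref_add _ (m + 1), pref_succ, wordMap_append]
      · simp [pref_add _ (m + 1), pref_succ, wordMap_append, hp]
    constructor
    · refine ge_of_tendsto htend (eventually_atTop.2 ⟨m + 1, fun M hM => ?_⟩)
      obtain ⟨x, hx, y, hy, e1, e2⟩ := key M hM
      rw [e1, e2]
      exact hG.lower _ _ _ hne x hx y hy
    · refine le_of_tendsto htend (eventually_atTop.2 ⟨m + 1, fun M hM => ?_⟩)
      obtain ⟨x, hx, y, hy, e1, e2⟩ := key M hM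
      rw [e1, e2]
      exact hG.upper _ _ (hG.mem _ _ hx) _ (hG.mem _ _ hy)

theorem exists_first_difference {ω ω' : ℕ → Fin n} (h : ω ≠ ω') :
    ∃ m, (∀ k < m, ω k = ω' k) ∧ ω m ≠ ω' m := by
  classical
  have hex : ∃ m, ω m ≠ ω' m := Function.ne_iff.1 h
  exact ⟨Nat.find hex, fun k hk => not_not.1 (Nat.find_min hex hk), Nat.find_spec hex⟩

/-- Two sets generated at scale with the same ratios are Lipschitz equivalent. -/
theorem GeneratesAtScale.lipschitzEquivalent {ρ : Fin n → ℝ} {E F : Set ℝ}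
    {H G : Fin n → ℝ → ℝ} {c C c' C' : ℝ} (h0 : ∀ i, 0 < ρ i) (h1 : ∀ i, ρ i < 1)
    (hE : GeneratesAtScale ρ E H c C) (hF : GeneratesAtScale ρ F G c' C')
    (hc : 0 < c) (hC : 0 < C) (hc' : 0 < c') (hC' : 0 < C') : LipschitzEquivalent E F := by
  obtain ⟨π, πE, πs, πd⟩ := hE.exists_coding h0 h1
  obtain ⟨σ, σF, σs, σd⟩ := hF.exists_coding h0 h1
  have inj : ∀ {c C : ℝ} {π : (ℕ → Fin n) → ℝ}, 0 < c → (∀ ω ω' m, (∀ k < m, ω k = ω' k) →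
      ω m ≠ ω' m → c * wordRatio ρ (pref ω m) ≤ |π ω - π ω'| ∧
        |π ω - π ω'| ≤ C * wordRatio ρ (pref ω m)) → Function.Injective π := by
    intro c C π hc h ω ω' he
    by_contra hne
    obtain ⟨m, hm, hm'⟩ := exists_first_difference hne
    have := (h ω ω' m hm hm').1
    rw [he, sub_self, abs_zero] at this
    exact absurd this (not_le.2 (mul_pos hc (wordRatio_pos h0 _)))
  have : Nonempty (Fin n) := ⟨(hE.cover _ hE.nonempty.some_mem).choose⟩
  choose! code hcode using πs
  -- Both distances lie between fixed multiples of the same ratio `R`, which is eliminated to give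
  -- the two constants.
  refine ⟨fun x => ⟨σ (code x), σF _⟩, ⟨?_, ?_⟩, c' / C, C' / c, by positivity, by positivity, ?_⟩
  · intro x y hxy
    have h2 : code x = code y := inj hc' σd (congrArg Subtype.val hxy)
    exact Subtype.ext (by rw [← hcode x x.2, h2, hcode y y.2])
  · rintro ⟨y, hy⟩
    obtain ⟨ω, rfl⟩ := σs y hy
    refine ⟨⟨π ω, πE ω⟩, Subtype.ext ?_⟩
    exact congrArg σ (inj hc πd (hcode _ (πE ω)))
  · rintro ⟨x, hx⟩ ⟨y, hy⟩
    rw [Subtype.dist_eq, Subtype.dist_eq, Real.dist_eq, Real.dist_eq]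
    change c' / C * |x - y| ≤ |σ (code x) - σ (code y)| ∧
      |σ (code x) - σ (code y)| ≤ C' / c * |x - y|
    by_cases hxy : code x = code y
    · have : x = y := by rw [← hcode x hx, hxy, hcode y hy]
      simp [this]
    · obtain ⟨m, hm, hm'⟩ := exists_first_difference hxy
      have e1 := πd _ _ m hm hm'
      have e2 := σd _ _ m hm hm'
      rw [hcode x hx, hcode y hy] at e1
      set R := wordRatio ρ (pref (code x) m)
      constructor
      · rw [div_mul_eq_mul_div, div_le_iff₀ hC]
        nlinarith [mul_le_mul_of_nonneg_left e1.2 hc'.le, mul_le_mul_of_nonneg_left e2.1 hC.le]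
      · rw [div_mul_eq_mul_div, le_div_iff₀ hc]
        nlinarith [mul_le_mul_of_nonneg_left e1.1 hC'.le, mul_le_mul_of_nonneg_left e2.2 hc.le]

theorem wordMap_similitude {ρ : Fin n → ℝ} {Φ : Fin n → ℝ → ℝ}
    (h : ∀ i, IsSimilitude (ρ i) (Φ i)) (w : List (Fin n)) (x y : ℝ) :
    |wordMap Φ w x - wordMap Φ w y| = wordRatio ρ w * |x - y| := by
  induction w with
  | nil => simp
  | cons j w ih =>
    have := h j (wordMap Φ w x) (wordMap Φ w y)
    rw [Real.dist_eq, Real.dist_eq] at this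
    rw [wordMap_cons, wordMap_cons, this, ih, wordRatio_cons, mul_assoc]

theorem IsSimilitude.continuous {r : ℝ} {f : ℝ → ℝ} (h : IsSimilitude r f) : Continuous f :=
  (LipschitzWith.of_dist_le_mul (K := r.toNNReal) fun x y => by
    rw [h x y]
    exact mul_le_mul_of_nonneg_right (Real.le_coe_toNNReal r) dist_nonneg).continuous

/-- Finitely many pairwise disjoint compact sets are uniformly separated. -/
theorem exists_separation {K : Fin n → Set ℝ} (hK : ∀ i, IsCompact (K i))
    (hd : ∀ i j, i ≠ j → Disjoint (K i) (K j)) :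
    ∃ c, 0 < c ∧ ∀ i j, i ≠ j → ∀ x ∈ K i, ∀ y ∈ K j, c ≤ |x - y| := by
  have h : ∀ p : Fin n × Fin n, ∃ c, 0 < c ∧ (p.1 ≠ p.2 → ∀ x ∈ K p.1, ∀ y ∈ K p.2,
      c ≤ |x - y|) := by
    rintro ⟨i, j⟩
    by_cases hij : i = j
    · exact ⟨1, one_pos, fun h => absurd hij h⟩
    · obtain ⟨r, hr, hr'⟩ :=
        Metric.exists_pos_forall_lt_edist (hK i) (hK j).isClosed (hd i j hij)
      refine ⟨r, hr, fun _ x hx y hy => ?_⟩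
      have := hr' x hx y hy
      rw [edist_dist, ENNReal.lt_ofReal_iff_toReal_lt (by simp)] at this
      exact this.le
  choose c hc hc' using h
  rcases isEmpty_or_nonempty (Fin n) with he | he
  · exact ⟨1, one_pos, fun i => he.elim i⟩
  · obtain ⟨p, hp⟩ := Finite.exists_min c
    exact ⟨c p, hc p, fun i j hij x hx y hy => (hp (i, j)).trans (hc' (i, j) hij x hx y hy)⟩

/-- Similitudes scale the diameter of `D` and the distances between its disjoint compact first-level
pieces exactly by the ratio of the word. -/
theorem IsDustLike.generatesAtScale {ρ : Fin n → ℝ} (h0 : ∀ i, 0 < ρ i) {D : Set ℝ}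
    (hD : IsDustLike ρ D) :
    ∃ Φ c C, 0 < c ∧ 0 < C ∧ GeneratesAtScale ρ D Φ c C := by
  obtain ⟨Φ, hΦ, ⟨hne, hcpt, hU⟩, hdisj⟩ := hD
  obtain ⟨c, hc, hsep⟩ := exists_separation
    (fun i => hcpt.image (hΦ i).continuous) hdisj
  obtain ⟨B, hB⟩ := Metric.isBounded_iff.1 hcpt.isBounded
  refine ⟨Φ, c, max B 1, hc, by positivity, hcpt, hne, ?_, ?_, ?_, ?_⟩
  · intro j x hx
    rw [← hU]
    exact Set.mem_iUnion.2 ⟨j, x, hx, rfl⟩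
  · intro x hx
    rw [← hU] at hx
    obtain ⟨j, y, hy, e⟩ := Set.mem_iUnion.1 hx
    exact ⟨j, y, hy, e⟩
  · intro w x hx y hy
    rw [wordMap_similitude hΦ, mul_comm]
    exact mul_le_mul_of_nonneg_right ((hB hx hy).trans (le_max_left _ _)) (wordRatio_pos h0 _).le
  · intro w i j hij x hx y hy
    rw [wordMap_similitude hΦ, mul_comm]
    exact mul_le_mul_of_nonneg_left (hsep i j hij _ ⟨x, hx, rfl⟩ _ ⟨y, hy, rfl⟩)
      (wordRatio_pos h0 _).le

end Coding

/-! ### Touching systems: order, addresses and the attractor -/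

/-- An iterated function system of the line with touching pieces and at least one gap, together
with the exponents which witness the multiplicative relations between its ratios. -/
structure TouchSystem (n : ℕ) where
  ρ : Fin n → ℝ
  t : Fin n → ℝ
  T : Set ℝ
  ρ_pos : ∀ i, 0 < ρ i
  ρ_lt : ∀ i, ρ i < 1
  ordered : ∀ i j : Fin n, i < j → affineIFS ρ t i 1 ≤ affineIFS ρ t j 0
  o : Fin n
  l : Fin n
  a : Fin n
  suc : Fin n → Fin n
  o_val : (o : ℕ) = 0
  l_val : (l : ℕ) + 1 = n
  suc_val : ∀ i, i ≠ l → (suc i : ℕ) = i + 1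
  left_end : affineIFS ρ t o 0 = 0
  right_end : affineIFS ρ t l 1 = 1
  attractor : IsAttractor (affineIFS ρ t) T
  a_ne : a ≠ l
  gap : affineIFS ρ t a 1 < affineIFS ρ t (suc a) 0
  p : ℕ
  q : ℕ
  p_pos : 0 < p
  q_pos : 0 < q
  pow_eq : ρ o ^ p = ρ l ^ q
  -- The exponents make the word `J` below fit exactly; `d < c` keeps `J` clear of the piece `l^c`
  -- when `suc i = l`.
  d : Fin n → ℕ
  c : Fin n → ℕ
  d_pos : ∀ i, i ≠ l → affineIFS ρ t i 1 = affineIFS ρ t (suc i) 0 → 0 < d i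
  d_lt_c : ∀ i, i ≠ l → affineIFS ρ t i 1 = affineIFS ρ t (suc i) 0 → d i < c i
  ratio : ∀ i, i ≠ l → affineIFS ρ t i 1 = affineIFS ρ t (suc i) 0 →
    ρ (suc i) ^ d i * ρ o ^ d i * ρ a ^ d i * ρ l ^ d i = ρ l ^ c i

namespace TouchSystem

variable {n : ℕ} (S : TouchSystem n)

/-- The maps of the system. -/
def Ψ : Fin n → ℝ → ℝ := affineIFS S.ρ S.t

/-- The compositions of the maps of the system. -/
def W : List (Fin n) → ℝ → ℝ := wordMap S.Ψ

/-- The ratios of the compositions of the maps of the system. -/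
def R : List (Fin n) → ℝ := wordRatio S.ρ

/-- The letter `i` is touching: the `i`-th interval touches the next one. -/
def Tch (i : Fin n) : Prop := i ≠ S.l ∧ S.Ψ i 1 = S.Ψ (S.suc i) 0

@[simp] theorem W_nil (x : ℝ) : S.W [] x = x := rfl

@[simp] theorem W_cons (j : Fin n) (w : List (Fin n)) (x : ℝ) :
    S.W (j :: w) x = S.Ψ j (S.W w x) := rfl

theorem W_append (u v : List (Fin n)) (x : ℝ) : S.W (u ++ v) x = S.W u (S.W v x) :=
  wordMap_append _ _ _ _

@[simp] theorem R_nil : S.R [] = 1 := rfl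

@[simp] theorem R_cons (j : Fin n) (w : List (Fin n)) : S.R (j :: w) = S.ρ j * S.R w :=
  wordRatio_cons _ _ _

@[simp] theorem R_append (u v : List (Fin n)) : S.R (u ++ v) = S.R u * S.R v :=
  wordRatio_append _ _ _

@[simp] theorem R_replicate (m : ℕ) (j : Fin n) : S.R (List.replicate m j) = S.ρ j ^ m :=
  wordRatio_replicate _ _ _

@[simp] theorem Ψ_o_zero : S.Ψ S.o 0 = 0 := S.left_end

@[simp] theorem Ψ_l_one : S.Ψ S.l 1 = 1 := S.right_end

theorem Ψ_a_lt : S.Ψ S.a 1 < S.Ψ (S.suc S.a) 0 := S.gap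

theorem Ψ_sub (j : Fin n) (x y : ℝ) : S.Ψ j x - S.Ψ j y = S.ρ j * (x - y) := by
  simp only [Ψ, affineIFS]; ring

theorem W_sub (w : List (Fin n)) (x y : ℝ) : S.W w x - S.W w y = S.R w * (x - y) := by
  induction w with
  | nil => simp
  | cons j w ih => rw [W_cons, W_cons, Ψ_sub, ih, R_cons, mul_assoc]

theorem R_pos (w : List (Fin n)) : 0 < S.R w := wordRatio_pos S.ρ_pos w

theorem R_le_one (w : List (Fin n)) : S.R w ≤ 1 := wordRatio_le_one S.ρ_pos S.ρ_lt w

theorem W_le_iff (w : List (Fin n)) {x y : ℝ} : S.W w x ≤ S.W w y ↔ x ≤ y := by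
  have h := S.W_sub w x y
  have hp := S.R_pos w
  constructor
  · intro h1
    by_contra h2
    nlinarith [mul_pos hp (sub_pos.2 (not_le.1 h2))]
  · intro h1
    nlinarith [mul_nonneg hp.le (sub_nonneg.2 h1)]

theorem W_lt_iff (w : List (Fin n)) {x y : ℝ} : S.W w x < S.W w y ↔ x < y := by
  rw [← not_le, ← not_le, W_le_iff]

theorem W_inj (w : List (Fin n)) {x y : ℝ} : S.W w x = S.W w y ↔ x = y := by
  rw [le_antisymm_iff, le_antisymm_iff, W_le_iff, W_le_iff]

theorem Ψ_le_iff (j : Fin n) {x y : ℝ} : S.Ψ j x ≤ S.Ψ j y ↔ x ≤ y := S.W_le_iff [j]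

theorem Ψ_lt_iff (j : Fin n) {x y : ℝ} : S.Ψ j x < S.Ψ j y ↔ x < y := S.W_lt_iff [j]

theorem Ψ_inj (j : Fin n) {x y : ℝ} : S.Ψ j x = S.Ψ j y ↔ x = y := S.W_inj [j]

theorem o_le (j : Fin n) : S.o ≤ j := by
  rw [Fin.le_def, S.o_val]; exact Nat.zero_le _

theorem le_l (j : Fin n) : j ≤ S.l := by
  have := S.l_val; rw [Fin.le_def]; omega

theorem lt_l {j : Fin n} (h : j ≠ S.l) : j < S.l := lt_of_le_of_ne (S.le_l j) h

theorem a_lt : S.a < S.l := S.lt_l S.a_ne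

theorem suc_gt {i : Fin n} (h : i ≠ S.l) : i < S.suc i := by
  rw [Fin.lt_def, S.suc_val i h]; omega

theorem suc_le {i j : Fin n} (h : i < j) : S.suc i ≤ j := by
  have hi : i ≠ S.l := (h.trans_le (S.le_l j)).ne
  rw [Fin.le_def, S.suc_val i hi]; exact h

theorem suc_inj {i j : Fin n} (hi : i ≠ S.l) (hj : j ≠ S.l) (h : S.suc i = S.suc j) : i = j := by
  have h1 := S.suc_val i hi
  have h2 := S.suc_val j hj
  rw [h] at h1
  exact Fin.ext (by omega)

theorem suc_ne_o {i : Fin n} (h : i ≠ S.l) : S.suc i ≠ S.o :=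
  ((S.o_le i).trans_lt (S.suc_gt h)).ne'

theorem not_tch_a : ¬ S.Tch S.a := fun h => S.Ψ_a_lt.ne h.2

theorem o_ne_l : S.o ≠ S.l := ((S.o_le S.a).trans_lt S.a_lt).ne

theorem Ψ_le_of_lt {i j : Fin n} (h : i < j) {x y : ℝ} (hx : x ≤ 1) (hy : 0 ≤ y) :
    S.Ψ i x ≤ S.Ψ j y :=
  ((S.Ψ_le_iff i).2 hx).trans ((S.ordered i j h).trans ((S.Ψ_le_iff j).2 hy))

theorem Ψ_nonneg (j : Fin n) {x : ℝ} (hx : 0 ≤ x) : 0 ≤ S.Ψ j x := by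
  rcases (S.o_le j).eq_or_lt with h | h
  · rw [← h, ← S.Ψ_o_zero]; exact (S.Ψ_le_iff _).2 hx
  · rw [← S.Ψ_o_zero]; exact S.Ψ_le_of_lt h zero_le_one hx

theorem Ψ_le_one (j : Fin n) {x : ℝ} (hx : x ≤ 1) : S.Ψ j x ≤ 1 := by
  rcases (S.le_l j).eq_or_lt with h | h
  · rw [h, ← S.Ψ_l_one]; exact (S.Ψ_le_iff _).2 hx
  · rw [← S.Ψ_l_one]; exact S.Ψ_le_of_lt h hx zero_le_one

theorem W_nonneg (w : List (Fin n)) {x : ℝ} (hx : 0 ≤ x) : 0 ≤ S.W w x := by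
  induction w with
  | nil => exact hx
  | cons j w ih => exact S.Ψ_nonneg j ih

theorem W_le_one (w : List (Fin n)) {x : ℝ} (hx : x ≤ 1) : S.W w x ≤ 1 := by
  induction w with
  | nil => exact hx
  | cons j w ih => exact S.Ψ_le_one j ih

theorem W_pos (w : List (Fin n)) {x : ℝ} (hx : 0 < x) : 0 < S.W w x :=
  (S.W_nonneg w le_rfl).trans_lt ((S.W_lt_iff w).2 hx)

theorem Ψ_mem {j : Fin n} {x : ℝ} (hx : x ∈ S.T) : S.Ψ j x ∈ S.T := by
  rw [← S.attractor.2.2]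
  exact Set.mem_iUnion.2 ⟨j, x, hx, rfl⟩

theorem W_mem (w : List (Fin n)) {x : ℝ} (hx : x ∈ S.T) : S.W w x ∈ S.T :=
  wordMap_mem (fun _ _ h => S.Ψ_mem h) w hx

theorem exists_Ψ {x : ℝ} (hx : x ∈ S.T) : ∃ j, ∃ y ∈ S.T, S.Ψ j y = x := by
  rw [← S.attractor.2.2] at hx
  obtain ⟨j, y, hy, e⟩ := Set.mem_iUnion.1 hx
  exact ⟨j, y, hy, e⟩

/-- The maximum `M` is attained in some interval `j`, whence `M - 1 ≤ ρ_j (M - 1)` with `ρ_j < 1`.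
-/
theorem le_one {x : ℝ} (hx : x ∈ S.T) : x ≤ 1 := by
  obtain ⟨M, hM, hmax⟩ := S.attractor.2.1.exists_isMaxOn S.attractor.1 continuousOn_id
  have hmax : ∀ y ∈ S.T, y ≤ M := fun y hy => hmax hy
  refine (hmax x hx).trans ?_
  obtain ⟨j, y, hy, e⟩ := S.exists_Ψ hM
  have h1 := S.Ψ_sub j y 1
  have h2 := S.Ψ_le_one j (le_refl (1 : ℝ))
  have h3 := hmax y hy
  have h4 := S.ρ_pos j
  have h5 := S.ρ_lt j
  by_contra hc
  push Not at hc
  nlinarith [mul_le_mul_of_nonneg_left h3 h4.le]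

theorem nonneg {x : ℝ} (hx : x ∈ S.T) : 0 ≤ x := by
  obtain ⟨M, hM, hmin⟩ := S.attractor.2.1.exists_isMinOn S.attractor.1 continuousOn_id
  have hmin : ∀ y ∈ S.T, M ≤ y := fun y hy => hmin hy
  refine le_trans ?_ (hmin x hx)
  obtain ⟨j, y, hy, e⟩ := S.exists_Ψ hM
  have h1 := S.Ψ_sub j y 0
  have h2 := S.Ψ_nonneg j (le_refl (0 : ℝ))
  have h3 := hmin y hy
  have h4 := S.ρ_pos j
  have h5 := S.ρ_lt j
  by_contra hc
  push Not at hc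
  nlinarith [mul_le_mul_of_nonneg_left h3 h4.le]

theorem W_replicate_l_one (m : ℕ) : S.W (List.replicate m S.l) 1 = 1 := by
  induction m with
  | zero => rfl
  | succ m ih => rw [List.replicate_succ, W_cons, ih, S.Ψ_l_one]

theorem W_replicate_o_zero (m : ℕ) : S.W (List.replicate m S.o) 0 = 0 := by
  induction m with
  | zero => rfl
  | succ m ih => rw [List.replicate_succ, W_cons, ih, S.Ψ_o_zero]

theorem mem_of_fixed {j : Fin n} {x : ℝ} (h : ∀ m, S.W (List.replicate m j) x = x) : x ∈ S.T := by
  obtain ⟨y, hy⟩ := S.attractor.1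
  have ht : Tendsto (fun m => S.W (List.replicate m j) y) atTop (𝓝 x) := by
    have h0 : Tendsto (fun m => S.ρ j ^ m * (y - x) + x) atTop (𝓝 (0 * (y - x) + x)) :=
      ((tendsto_pow_atTop_nhds_zero_of_lt_one (S.ρ_pos j).le (S.ρ_lt j)).mul_const _).add_const _
    rw [zero_mul, zero_add] at h0
    refine h0.congr fun m => ?_
    have := S.W_sub (List.replicate m j) y x
    rw [h m, R_replicate] at this
    linarith
  exact S.attractor.2.1.isClosed.mem_of_tendsto ht (Eventually.of_forall fun m => S.W_mem _ hy)

theorem one_mem : (1 : ℝ) ∈ S.T := S.mem_of_fixed S.W_replicate_l_one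

theorem zero_mem : (0 : ℝ) ∈ S.T := S.mem_of_fixed S.W_replicate_o_zero

/-- Positive points have at most one address. -/
theorem Ψ_parse {i j : Fin n} {x y : ℝ} (hx : 0 < x) (hx1 : x ≤ 1) (hy : 0 < y) (hy1 : y ≤ 1)
    (h : S.Ψ i x = S.Ψ j y) : i = j ∧ x = y := by
  rcases lt_trichotomy i j with hij | rfl | hij
  · have h1 := S.Ψ_le_of_lt hij hx1 le_rfl
    have h2 := (S.Ψ_lt_iff j).2 hy
    exact absurd h (h1.trans_lt h2).ne
  · exact ⟨rfl, (S.Ψ_inj i).1 h⟩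
  · have h1 := S.Ψ_le_of_lt hij hy1 le_rfl
    have h2 := (S.Ψ_lt_iff i).2 hx
    exact absurd h (h1.trans_lt h2).ne'

theorem W_head {i j : Fin n} {s u : List (Fin n)} {x y : ℝ} (hx : 0 < x) (hx1 : x ≤ 1) (hy : 0 < y)
    (hy1 : y ≤ 1) (h : S.W (i :: s) x = S.W (j :: u) y) : i = j ∧ S.W s x = S.W u y :=
  S.Ψ_parse (S.W_pos s hx) (S.W_le_one s hx1) (S.W_pos u hy) (S.W_le_one u hy1) h

theorem W_lt_one {w : List (Fin n)} {g : Fin n} (hg : g ∈ w) (hgl : g ≠ S.l) {x : ℝ}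
    (hx : x ≤ 1) : S.W w x < 1 := by
  induction w with
  | nil => simp at hg
  | cons j w ih =>
    by_cases hj : j = S.l
    · have hgw : g ∈ w := by
        rcases List.mem_cons.1 hg with h | h
        · exact absurd (h.trans hj) hgl
        · exact h
      rw [W_cons, hj, ← S.Ψ_l_one]
      exact (S.Ψ_lt_iff _).2 (ih hgw)
    · refine (S.Ψ_le_of_lt (S.lt_l hj) (S.W_le_one w hx) le_rfl).trans_lt ?_
      rw [← S.Ψ_l_one]
      exact (S.Ψ_lt_iff _).2 one_pos

/-! ### The gap after `a` and the isolation of cylinders -/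

/-- The left end of the first interval after the gap. -/
def ζ : ℝ := S.Ψ (S.suc S.a) 0

/-- The length of the gap. -/
def γ : ℝ := S.ζ - S.Ψ S.a 1

/-- The part of the attractor on the right of the gap. -/
def Z : Set ℝ := {x | x ∈ S.T ∧ S.ζ ≤ x}

theorem γ_pos : 0 < S.γ := sub_pos.2 S.Ψ_a_lt

theorem γ_le_ζ : S.γ ≤ S.ζ := sub_le_self _ (S.Ψ_nonneg _ zero_le_one)

theorem ζ_pos : 0 < S.ζ := S.γ_pos.trans_le S.γ_le_ζ

theorem Z_pos {z : ℝ} (hz : z ∈ S.Z) : 0 < z := S.ζ_pos.trans_le hz.2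

theorem Z_le_one {z : ℝ} (hz : z ∈ S.Z) : z ≤ 1 := S.le_one hz.1

theorem Ψ_mem_Z {b : Fin n} (hb : S.a < b) {x : ℝ} (hx : x ∈ S.T) : S.Ψ b x ∈ S.Z := by
  refine ⟨S.Ψ_mem hx, ?_⟩
  rcases (S.suc_le hb).eq_or_lt with h | h
  · rw [← h]; exact (S.Ψ_le_iff _).2 (S.nonneg hx)
  · exact S.Ψ_le_of_lt h zero_le_one (S.nonneg hx)

theorem Ψ_le_of_le_a {b : Fin n} (hb : b ≤ S.a) {x : ℝ} (hx : x ≤ 1) : S.Ψ b x ≤ S.Ψ S.a 1 := by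
  rcases hb.eq_or_lt with h | h
  · rw [h]; exact (S.Ψ_le_iff _).2 hx
  · exact S.Ψ_le_of_lt h hx zero_le_one

theorem Ψ_notMem_Z {b : Fin n} (hb : b ≤ S.a) {x : ℝ} (hx : x ≤ 1) : S.Ψ b x ∉ S.Z := fun h =>
  absurd (h.2.trans (S.Ψ_le_of_le_a hb hx)) (not_le.2 S.Ψ_a_lt)

theorem mem_Z_or {x : ℝ} (hx : x ∈ S.T) : x ∈ S.Z ∨ x ≤ S.Ψ S.a 1 := by
  obtain ⟨b, y, hy, rfl⟩ := S.exists_Ψ hx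
  rcases lt_or_ge S.a b with h | h
  · exact Or.inl (S.Ψ_mem_Z h hy)
  · exact Or.inr (S.Ψ_le_of_le_a h (S.le_one hy))

theorem one_mem_Z : (1 : ℝ) ∈ S.Z := by
  have := S.Ψ_mem_Z S.a_lt S.one_mem
  rwa [S.Ψ_l_one] at this

theorem W_replicate_l_mem_Z (m : ℕ) {z : ℝ} (hz : z ∈ S.Z) :
    S.W (List.replicate m S.l) z ∈ S.Z := by
  induction m with
  | zero => exact hz
  | succ m ih => exact S.Ψ_mem_Z S.a_lt ih.1

theorem T_trichotomy (w : List (Fin n)) {x : ℝ} (hx : x ∈ S.T) :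
    (∃ y ∈ S.T, S.W w y = x) ∨ x ≤ S.W w 0 ∨ S.W w 1 ≤ x := by
  induction w generalizing x with
  | nil => exact Or.inl ⟨x, hx, rfl⟩
  | cons j w ih =>
    obtain ⟨i, y, hy, rfl⟩ := S.exists_Ψ hx
    rcases lt_trichotomy i j with h | rfl | h
    · exact Or.inr (Or.inl (S.Ψ_le_of_lt h (S.le_one hy) (S.W_nonneg w le_rfl)))
    · rcases ih hy with ⟨z, hz, rfl⟩ | h | h
      · exact Or.inl ⟨z, hz, rfl⟩
      · exact Or.inr (Or.inl ((S.Ψ_le_iff i).2 h))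
      · exact Or.inr (Or.inr ((S.Ψ_le_iff i).2 h))
    · exact Or.inr (Or.inr (S.Ψ_le_of_lt h (S.W_le_one w le_rfl) (S.nonneg hy)))

/-- The part `W w (Z)` of the attractor is isolated on the left. -/
theorem left_isolation (w : List (Fin n)) {x : ℝ} (hx : x ∈ S.T) :
    (x ≤ S.W w S.ζ - S.γ * S.R w) ∨ (∃ z ∈ S.Z, S.W w z = x) ∨ S.W w 1 ≤ x := by
  have hR := S.R_pos w
  rcases S.T_trichotomy w hx with ⟨y, hy, rfl⟩ | h | h
  · rcases S.mem_Z_or hy with h | h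
    · exact Or.inr (Or.inl ⟨y, h, rfl⟩)
    · left
      have h1 := S.W_sub w y S.ζ
      have h2 : y ≤ S.ζ - S.γ := by rw [γ]; linarith
      nlinarith
  · left
    have h1 := S.W_sub w S.ζ 0
    have h2 := S.γ_le_ζ
    nlinarith
  · exact Or.inr (Or.inr h)

/-- The interval of a word ending with `a l … l` is isolated on the right. -/
theorem right_isolation (w : List (Fin n)) (f : ℕ) {x : ℝ} (hx : x ∈ S.T) :
    x ≤ S.W (w ++ S.a :: List.replicate f S.l) 1 ∨
      S.W (w ++ S.a :: List.replicate f S.l) 1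
        + S.γ * S.R (w ++ S.a :: List.replicate f S.l) ≤ x := by
  have hR := S.R_pos w
  -- Since `l` fixes `1`, the right end is that of `w a`, and there the gap of the parent `w`
  -- begins.
  have e : S.W (w ++ S.a :: List.replicate f S.l) 1 = S.W w (S.Ψ S.a 1) := by
    rw [W_append, W_cons, S.W_replicate_l_one]
  have h1 : S.R (w ++ S.a :: List.replicate f S.l) ≤ S.R w := by
    rw [R_append]
    exact mul_le_of_le_one_right hR.le (S.R_le_one _)
  have h2 := S.W_sub w S.ζ (S.Ψ S.a 1)
  have h3 : S.γ * S.R (w ++ S.a :: List.replicate f S.l) ≤ S.γ * S.R w :=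
    mul_le_mul_of_nonneg_left h1 S.γ_pos.le
  have h4 : S.W w S.ζ - S.W w (S.Ψ S.a 1) = S.γ * S.R w := by rw [h2, γ]; ring
  rw [e]
  rcases S.T_trichotomy w hx with ⟨y, hy, rfl⟩ | h | h
  · rcases S.mem_Z_or hy with h | h
    · right
      have := (S.W_le_iff w).2 h.2
      linarith
    · exact Or.inl ((S.W_le_iff w).2 h)
  · left
    exact h.trans ((S.W_le_iff w).2 (S.Ψ_nonneg _ zero_le_one))
  · right
    have := (S.W_le_iff w).2 (S.Z_le_one ⟨S.Ψ_mem S.zero_mem, le_rfl⟩ : S.ζ ≤ 1)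
    linarith

theorem W_replicate_add (m k : ℕ) (j : Fin n) (x : ℝ) : S.W (List.replicate (m + k) j) x =
    S.W (List.replicate m j) (S.W (List.replicate k j) x) := by
  rw [← S.W_append, List.replicate_append_replicate]

/-! ### The pieces of the rewiring -/

/-- The word which leads, in the interval on the right of the touching point of `i`, to a copy of
the end of the interval on the left. -/
def J (i : Fin n) : List (Fin n) :=
  List.replicate (S.d i) S.o ++ i :: (List.replicate (S.d i - 1) (S.suc i) ++
    (List.replicate (S.d i) S.a ++ List.replicate (S.d i) S.l))

/-- The points of `Z` outside the smaller copy of `Z` at the right end. -/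
def Zshell : Set ℝ := {z | z ∈ S.Z ∧ ∀ z' ∈ S.Z, S.W (List.replicate S.q S.l) z' ≠ z}

/-- The pieces which are moved by the rewiring at the touching point of a letter. -/
inductive Piece (n : ℕ)
  | first (i : Fin n)
  | shift (i : Fin n) (k : ℕ)
  | swap (i : Fin n) (k : ℕ)

/-- The touching letter of a piece. -/
def Piece.base : Piece n → Fin n
  | .first i => i
  | .shift i _ => i
  | .swap i _ => i

/-- The interval in which a piece lies. -/
def letter : Piece n → Fin n
  | .first i => i
  | .shift i _ => S.suc i
  | .swap i _ => S.suc i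

/-- The position of a piece in its interval. -/
def src : Piece n → List (Fin n)
  | .first i => List.replicate (S.c i) S.l
  | .shift i k => List.replicate (S.p * k) S.o ++ (S.J i ++ List.replicate S.q S.l)
  | .swap i k => List.replicate (S.p * k) S.o ++ S.J i

/-- The position to which a piece is moved. -/
def tgt : Piece n → List (Fin n)
  | .first i => S.suc i :: (List.replicate (S.p * 0) S.o ++ S.J i)
  | .shift i k => S.suc i :: (List.replicate (S.p * (k + 1)) S.o ++ S.J i)
  | .swap i k => i :: List.replicate (S.c i + S.q * k) S.l

/-- The part of `Z` of which a piece is a copy. -/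
def dom : Piece n → Set ℝ
  | .first _ => S.Z
  | .shift _ _ => S.Z
  | .swap _ _ => S.Zshell

theorem dom_subset {P : Piece n} {z : ℝ} (hz : z ∈ S.dom P) : z ∈ S.Z := by
  cases P with
  | first i => exact hz
  | shift i k => exact hz
  | swap i k => exact hz.1

/-- With the letter `suc i` in front, `J` has `d` letters each of `suc i`, `o`, `a`, `l` and a
single `i`; the relation between the ratios turns the first four into `ρ_l^c`. -/
theorem ratio_J {i : Fin n} (hi : S.Tch i) : S.ρ (S.suc i) * S.R (S.J i) = S.ρ i * S.ρ S.l ^ S.c i := by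
  have h := S.ratio i hi.1 hi.2
  obtain ⟨e, he⟩ := Nat.exists_eq_succ_of_ne_zero (S.d_pos i hi.1 hi.2).ne'
  simp only [J, R_append, R_replicate, R_cons, ← h, he, Nat.succ_eq_add_one, Nat.add_sub_cancel,
    pow_succ]
  ring

/-- Moving a piece scales it exactly as `Ψ` of its letter would, which makes the rewired map a
similarity on the piece. -/
theorem ratio_tgt {P : Piece n} (hP : S.Tch P.base) :
    S.R (S.tgt P) = S.ρ (S.letter P) * S.R (S.src P) := by
  cases P with
  | first i => simpa [tgt, letter, src] using S.ratio_J (i := i) hP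
  | shift i k =>
    simp only [tgt, letter, src, R_cons, R_append, R_replicate, ← S.pow_eq, pow_mul, pow_succ]
    ring
  | swap i k =>
    have := S.ratio_J (i := i) hP
    simp only [tgt, letter, src, R_cons, R_append, R_replicate, pow_add, pow_mul, S.pow_eq]
    linear_combination -(S.ρ S.l ^ S.q) ^ k * this

/-- The initial run of `o` has to end for its length to be readable. If `i = o` it absorbs the
letter `i`; the next letter is `suc i`, or `a` when `d = 1`, and `a ≠ o` because `o` is then
touching while `a` is not. -/
theorem J_eq_run {i : Fin n} (hi : S.Tch i) :
    ∃ e g s, S.J i = List.replicate (e + 1) S.o ++ g :: s ∧ g ≠ S.o := by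
  obtain ⟨e, he⟩ := Nat.exists_eq_succ_of_ne_zero (S.d_pos i hi.1 hi.2).ne'
  by_cases hio : i = S.o
  · have hao : S.a ≠ S.o := fun h => S.not_tch_a (by rw [h, ← hio]; exact hi)
    have hs : S.suc i ≠ S.o := S.suc_ne_o hi.1
    have hr : ∀ s : List (Fin n), List.replicate (e + 1) S.o ++ i :: s =
        List.replicate (e + 1 + 1) S.o ++ s := by
      intro s
      rw [List.replicate_succ' (n := e + 1), hio, List.append_assoc]
      rfl
    rw [J, he, Nat.succ_eq_add_one, hr]
    cases e with
    | zero => exact ⟨1, S.a, _, rfl, hao⟩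
    | succ e => exact ⟨e + 1 + 1, S.suc i, _, rfl, hs⟩
  · exact ⟨e, i, _, by rw [J, he], hio⟩

theorem run_unique {m m' : ℕ} {g g' : Fin n} {s s' : List (Fin n)} {x x' : ℝ}
    (hg : g ≠ S.o) (hg' : g' ≠ S.o) (hx : 0 < x) (hx1 : x ≤ 1) (hx' : 0 < x') (hx1' : x' ≤ 1)
    (h : S.W (List.replicate m S.o ++ g :: s) x = S.W (List.replicate m' S.o ++ g' :: s') x') :
    m = m' ∧ g = g' ∧ S.W s x = S.W s' x' := by
  induction m generalizing m' with
  | zero =>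
    cases m' with
    | zero => exact ⟨rfl, S.W_head hx hx1 hx' hx1' h⟩
    | succ m' =>
      rw [List.replicate_succ, List.cons_append] at h
      exact absurd (S.W_head hx hx1 hx' hx1' h).1 hg
  | succ m ih =>
    cases m' with
    | zero =>
      rw [List.replicate_succ, List.cons_append] at h
      exact absurd (S.W_head hx hx1 hx' hx1' h).1.symm hg'
    | succ m' =>
      rw [List.replicate_succ, List.replicate_succ, List.cons_append, List.cons_append] at h
      obtain ⟨h1, h2⟩ := ih (S.W_head hx hx1 hx' hx1' h).2
      exact ⟨by rw [h1], h2⟩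

/-- The total length of the initial run of `o` determines `p * k`, hence the level. -/
theorem run_J_unique {i : Fin n} (hi : S.Tch i) {k k' : ℕ} {s s' : List (Fin n)} {x x' : ℝ}
    (hx : 0 < x) (hx1 : x ≤ 1) (hx' : 0 < x') (hx1' : x' ≤ 1)
    (h : S.W (List.replicate (S.p * k) S.o ++ (S.J i ++ s)) x =
      S.W (List.replicate (S.p * k') S.o ++ (S.J i ++ s')) x') : k = k' ∧ S.W s x = S.W s' x' := by
  have hk : k = k' := by
    obtain ⟨e, g, u, hJ, hg⟩ := S.J_eq_run hi
    rw [hJ] at h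
    simp only [List.append_assoc, List.cons_append] at h
    rw [← List.append_assoc, ← List.append_assoc, List.replicate_append_replicate,
      List.replicate_append_replicate] at h
    have := (S.run_unique hg hg hx hx1 hx' hx1' h).1
    exact Nat.eq_of_mul_eq_mul_left S.p_pos (by omega)
  subst hk
  refine ⟨rfl, ?_⟩
  rw [← List.append_assoc, ← List.append_assoc, S.W_append _ s, S.W_append _ s'] at h
  exact (S.W_inj _).1 h

/-- The words of the pieces on the right of a touching point start with `o`. -/
theorem exists_run_J_eq {i : Fin n} (hi : S.Tch i) (m : ℕ) (s : List (Fin n)) :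
    ∃ u, List.replicate m S.o ++ (S.J i ++ s) = S.o :: u := by
  obtain ⟨e, g, v, hJ, -⟩ := S.J_eq_run hi
  rw [hJ, List.append_assoc, ← List.append_assoc, List.replicate_append_replicate, ← add_assoc,
    List.replicate_succ]
  exact ⟨_, rfl⟩

theorem c_pos {i : Fin n} (hi : S.Tch i) : 0 < S.c i :=
  (S.d_pos i hi.1 hi.2).trans (S.d_lt_c i hi.1 hi.2)

theorem src_first {i : Fin n} (hi : S.Tch i) :
    ∃ m, List.replicate (S.c i) S.l = S.l :: List.replicate m S.l := by
  obtain ⟨m, hm⟩ := Nat.exists_eq_succ_of_ne_zero (S.c_pos hi).ne'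
  exact ⟨m, by rw [hm]; rfl⟩

/-- Sources in one interval are disjoint: near the right end words start with `l`, near the left end
with `o`; levels differ in the run of `o`, and at one level the shell excludes the inner copy. -/
theorem src_unique {P P' : Piece n} (hP : S.Tch P.base) (hP' : S.Tch P'.base)
    (hl : S.letter P = S.letter P') {z z' : ℝ} (hz : z ∈ S.dom P) (hz' : z' ∈ S.dom P')
    (h : S.W (S.src P) z = S.W (S.src P') z') : P = P' := by
  have hz0 := S.Z_pos (S.dom_subset hz)
  have hz1 := S.Z_le_one (S.dom_subset hz)
  have hz0' := S.Z_pos (S.dom_subset hz')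
  have hz1' := S.Z_le_one (S.dom_subset hz')
  have hmix : ∀ {i i' : Fin n}, S.Tch i → S.Tch i' → ∀ {m s x x'}, 0 < x → x ≤ 1 → 0 < x' →
      x' ≤ 1 → S.W (List.replicate (S.c i) S.l) x =
        S.W (List.replicate m S.o ++ (S.J i' ++ s)) x' → False := by
    intro i i' hi hi' m s x x' hx hx1 hx' hx1' he
    obtain ⟨r, hr⟩ := S.src_first hi
    obtain ⟨u, hu⟩ := S.exists_run_J_eq hi' m s
    rw [hr, hu] at he
    exact S.o_ne_l (S.W_head hx hx1 hx' hx1' he).1.symm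
  have nilapp : ∀ i k, S.src (.swap i k) = List.replicate (S.p * k) S.o ++ (S.J i ++ []) := by
    intro i k; simp [src]
  cases P with
  | first i =>
    cases P' with
    | first i' => exact congrArg _ hl
    | shift i' k' => exact (hmix hP hP' hz0 hz1 hz0' hz1' h).elim
    | swap i' k' => rw [nilapp] at h; exact (hmix hP hP' hz0 hz1 hz0' hz1' h).elim
  | shift i k =>
    cases P' with
    | first i' => exact (hmix hP' hP hz0' hz1' hz0 hz1 h.symm).elim
    | shift i' k' =>
      obtain rfl : i = i' := S.suc_inj hP.1 hP'.1 hl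
      rw [(S.run_J_unique hP hz0 hz1 hz0' hz1' h).1]
    | swap i' k' =>
      obtain rfl : i = i' := S.suc_inj hP.1 hP'.1 hl
      rw [nilapp] at h
      exact absurd (S.run_J_unique hP hz0 hz1 hz0' hz1' h).2 (hz'.2 _ hz)
  | swap i k =>
    rw [nilapp] at h
    cases P' with
    | first i' => exact (hmix hP' hP hz0' hz1' hz0 hz1 h.symm).elim
    | shift i' k' =>
      obtain rfl : i = i' := S.suc_inj hP.1 hP'.1 hl
      exact absurd (S.run_J_unique hP hz0 hz1 hz0' hz1' h).2.symm (hz.2 _ hz')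
    | swap i' k' =>
      obtain rfl : i = i' := S.suc_inj hP.1 hP'.1 hl
      rw [nilapp] at h
      rw [(S.run_J_unique hP hz0 hz1 hz0' hz1' h).1]

/-- A deeper shell lies in the inner copy that the shallower shell leaves out. -/
theorem shell_unique {m k k' : ℕ} {z z' : ℝ} (hz : z ∈ S.Zshell) (hz' : z' ∈ S.Zshell)
    (h : S.W (List.replicate (m + S.q * k) S.l) z = S.W (List.replicate (m + S.q * k') S.l) z') :
    k = k' := by
  have key : ∀ {k k' : ℕ} {z z' : ℝ}, z ∈ S.Zshell → z' ∈ S.Zshell →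
      S.W (List.replicate (m + S.q * k) S.l) z = S.W (List.replicate (m + S.q * k') S.l) z' →
      ¬ k < k' := by
    intro k k' z z' hz hz' h hlt
    obtain ⟨r, rfl⟩ := Nat.exists_eq_add_of_lt hlt
    have e : m + S.q * (k + r + 1) = (m + S.q * k) + (S.q + S.q * r) := by ring
    rw [e, S.W_replicate_add (m + S.q * k), S.W_inj, S.W_replicate_add S.q] at h
    exact hz.2 _ (S.W_replicate_l_mem_Z _ hz'.1) h.symm
  exact le_antisymm (not_lt.1 (key hz' hz h.symm)) (not_lt.1 (key hz hz' h))

/-- Targets are disjoint across all letters. Even if two of them share an interval, the next letter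
is `o` on the right of a touching point and `l` on the left of one. -/
theorem tgt_unique {P P' : Piece n} (hP : S.Tch P.base) (hP' : S.Tch P'.base)
    {z z' : ℝ} (hz : z ∈ S.dom P) (hz' : z' ∈ S.dom P')
    (h : S.W (S.tgt P) z = S.W (S.tgt P') z') : P = P' := by
  have hz0 := S.Z_pos (S.dom_subset hz)
  have hz1 := S.Z_le_one (S.dom_subset hz)
  have hz0' := S.Z_pos (S.dom_subset hz')
  have hz1' := S.Z_le_one (S.dom_subset hz')
  have huu : ∀ {i i' : Fin n}, S.Tch i → S.Tch i' → ∀ {k k' : ℕ},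
      S.W (S.suc i :: (List.replicate (S.p * k) S.o ++ S.J i)) z =
        S.W (S.suc i' :: (List.replicate (S.p * k') S.o ++ S.J i')) z' → i = i' ∧ k = k' := by
    intro i i' hi hi' k k' he
    obtain ⟨h1, h2⟩ := S.W_head hz0 hz1 hz0' hz1' he
    obtain rfl : i = i' := S.suc_inj hi.1 hi'.1 h1
    refine ⟨rfl, (S.run_J_unique hi hz0 hz1 hz0' hz1' (s := []) (s' := []) ?_).1⟩
    simpa using h2
  have huv : ∀ {i i' : Fin n}, S.Tch i → S.Tch i' → ∀ {m m' : ℕ} {x x' : ℝ}, 0 < x → x ≤ 1 →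
      0 < x' → x' ≤ 1 → S.W (S.suc i :: (List.replicate m S.o ++ S.J i)) x =
        S.W (i' :: List.replicate (S.c i' + m') S.l) x' → False := by
    intro i i' hi hi' m m' x x' hx hx1 hx' hx1' he
    have h2 := (S.W_head hx hx1 hx' hx1' he).2
    obtain ⟨r, hr⟩ := S.src_first hi'
    obtain ⟨u, hu⟩ := S.exists_run_J_eq hi m []
    rw [List.append_nil] at hu
    rw [hu, ← List.replicate_append_replicate, hr, List.cons_append] at h2
    exact S.o_ne_l (S.W_head hx hx1 hx' hx1' h2).1
  cases P with
  | first i =>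
    cases P' with
    | first i' => exact congrArg _ (huu hP hP' h).1
    | shift i' k' => exact absurd (huu hP hP' h).2 (Nat.succ_ne_zero k').symm
    | swap i' k' => exact (huv hP hP' hz0 hz1 hz0' hz1' h).elim
  | shift i k =>
    cases P' with
    | first i' => exact absurd (huu hP hP' h).2 (Nat.succ_ne_zero k)
    | shift i' k' =>
      obtain ⟨h1, h2⟩ := huu hP hP' h
      exact congrArg₂ _ h1 (Nat.succ_injective h2)
    | swap i' k' => exact (huv hP hP' hz0 hz1 hz0' hz1' h).elim
  | swap i k =>
    cases P' with
    | first i' => exact (huv hP' hP hz0' hz1' hz0 hz1 h.symm).elim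
    | shift i' k' => exact (huv hP' hP hz0' hz1' hz0 hz1 h.symm).elim
    | swap i' k' =>
      obtain ⟨rfl, h2⟩ := S.W_head hz0 hz1 hz0' hz1' h
      rw [S.shell_unique hz hz' h2]

/-! ### The rewired maps and their bijectivity -/

/-- The rewiring moves the point `y` of the interval `j` to `x`. -/
def Rew (j : Fin n) (y x : ℝ) : Prop :=
  ∃ P : Piece n, S.Tch P.base ∧ S.letter P = j ∧
    ∃ z ∈ S.dom P, S.W (S.src P) z = y ∧ S.W (S.tgt P) z = x

theorem Rew.unique {S : TouchSystem n} {j : Fin n} {y x x' : ℝ} (h : S.Rew j y x)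
    (h' : S.Rew j y x') : x = x' := by
  obtain ⟨P, hP, hj, z, hz, e, rfl⟩ := h
  obtain ⟨P', hP', hj', z', hz', e', rfl⟩ := h'
  obtain rfl := S.src_unique hP hP' (hj.trans hj'.symm) hz hz' (e.trans e'.symm)
  rw [(S.W_inj _).1 (e.trans e'.symm)]

open Classical in
/-- The rewired system: the interval `j` is embedded by `Ψ j`, except that some pieces near the
touching points are moved. -/
noncomputable def H (j : Fin n) (y : ℝ) : ℝ :=
  if h : ∃ x, S.Rew j y x then h.choose else S.Ψ j y

theorem H_of_rew {j : Fin n} {y x : ℝ} (h : S.Rew j y x) : S.H j y = x := by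
  have hex : ∃ x, S.Rew j y x := ⟨x, h⟩
  rw [H, dif_pos hex]
  exact hex.choose_spec.unique h

theorem H_of_not {j : Fin n} {y : ℝ} (h : ∀ x, ¬ S.Rew j y x) : S.H j y = S.Ψ j y := by
  rw [H, dif_neg (not_exists.2 h)]

theorem H_piece {P : Piece n} (hP : S.Tch P.base) {z : ℝ} (hz : z ∈ S.dom P) :
    S.H (S.letter P) (S.W (S.src P) z) = S.W (S.tgt P) z :=
  S.H_of_rew ⟨P, hP, rfl, z, hz, rfl, rfl⟩

theorem H_cases (j : Fin n) (y : ℝ) :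
    (∃ P : Piece n, S.Tch P.base ∧ S.letter P = j ∧
      ∃ z ∈ S.dom P, S.W (S.src P) z = y ∧ S.W (S.tgt P) z = S.H j y) ∨
    ((∀ x, ¬ S.Rew j y x) ∧ S.H j y = S.Ψ j y) := by
  by_cases h : ∃ x, S.Rew j y x
  · obtain ⟨x, hx⟩ := h
    left
    rw [S.H_of_rew hx]
    exact hx
  · push Not at h
    exact Or.inr ⟨h, S.H_of_not h⟩

theorem H_mem {j : Fin n} {y : ℝ} (hy : y ∈ S.T) : S.H j y ∈ S.T := by
  rcases S.H_cases j y with ⟨P, -, -, z, hz, -, e⟩ | ⟨-, e⟩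
  · rw [← e]; exact S.W_mem _ (S.dom_subset hz).1
  · rw [e]; exact S.Ψ_mem hy

theorem Zshell_ne_one {z : ℝ} (hz : z ∈ S.Zshell) : z < 1 :=
  lt_of_le_of_ne (S.Z_le_one hz.1) fun h =>
    hz.2 1 S.one_mem_Z (by rw [h, S.W_replicate_l_one])

/-- A point on the right of a touching point is moved. -/
theorem rew_right {i : Fin n} (hi : S.Tch i) (k : ℕ) {z : ℝ} (hz : z ∈ S.Z) :
    ∃ x, S.Rew (S.suc i) (S.W (List.replicate (S.p * k) S.o ++ S.J i) z) x := by
  by_cases h : ∃ z' ∈ S.Z, S.W (List.replicate S.q S.l) z' = z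
  · obtain ⟨z', hz', rfl⟩ := h
    refine ⟨_, .shift i k, hi, rfl, z', hz', ?_, rfl⟩
    rw [← S.W_append, List.append_assoc]; rfl
  · push Not at h
    exact ⟨_, .swap i k, hi, rfl, z, ⟨hz, h⟩, rfl, rfl⟩

/-- A point on the left of a touching point is moved. -/
theorem rew_left {i : Fin n} (hi : S.Tch i) (m : ℕ) {z : ℝ} (hz : z ∈ S.Z) :
    ∃ x, S.Rew i (S.W (List.replicate (S.c i + m) S.l) z) x := by
  refine ⟨_, .first i, hi, rfl, _, S.W_replicate_l_mem_Z m hz, ?_, rfl⟩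
  rw [← List.replicate_append_replicate, S.W_append]; rfl

theorem a_mem_J {i : Fin n} (hi : S.Tch i) : S.a ∈ S.J i := by
  have := (S.d_pos i hi.1 hi.2).ne'
  simp [J, this]

/-- The target of a piece avoids the images of the pieces which are not moved. -/
theorem tgt_ne_of_not_rew {P : Piece n} (hP : S.Tch P.base) {z : ℝ} (hz : z ∈ S.dom P)
    {j : Fin n} {y : ℝ} (hy : y ∈ S.T) (hj : ∀ x, ¬ S.Rew j y x) :
    S.W (S.tgt P) z ≠ S.Ψ j y := by
  have hz0 := S.Z_pos (S.dom_subset hz)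
  have hz1 := S.Z_le_one (S.dom_subset hz)
  -- Every target is at a position of some interval `g` that is itself moved away by `g`, so no
  -- unmoved point of `g` occupies it. Being less than `1` there rules out a second address with `y
  -- = 0`.
  have key : ∀ {g s}, S.W s z < 1 → (∃ x, S.Rew g (S.W s z) x) → S.W (g :: s) z ≠ S.Ψ j y := by
    intro g s hs hex he
    rw [W_cons] at he
    rcases (S.nonneg hy).eq_or_lt with h0 | h0
    · rw [← h0] at he
      rcases lt_or_ge g j with hgj | hgj
      · have h1 := S.Ψ_le_of_lt hgj le_rfl le_rfl
        exact absurd he (((S.Ψ_lt_iff g).2 hs).trans_le h1).ne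
      · have h1 := (S.Ψ_lt_iff g).2 (S.W_pos s hz0)
        rcases hgj.eq_or_lt with h | h
        · rw [h] at he; exact absurd he h1.ne'
        · exact absurd he ((S.Ψ_le_of_lt h zero_le_one le_rfl).trans_lt h1).ne'
    · obtain ⟨rfl, rfl⟩ := S.Ψ_parse (S.W_pos s hz0) (S.W_le_one s hz1) h0 (S.le_one hy) he
      exact hj _ hex.choose_spec
  have hJ : ∀ {i m}, S.Tch i → S.W (List.replicate m S.o ++ S.J i) z < 1 := fun hi =>
    S.W_lt_one (List.mem_append_right _ (S.a_mem_J hi)) S.a_ne hz1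
  cases P with
  | first i => exact key (hJ hP) (S.rew_right hP _ hz)
  | shift i k => exact key (hJ hP) (S.rew_right hP _ hz)
  | swap i k =>
    refine key ?_ (S.rew_left hP _ hz.1)
    have := (S.W_lt_iff (List.replicate (S.c i + S.q * k) S.l)).2 (S.Zshell_ne_one hz)
    rwa [S.W_replicate_l_one] at this

/-- An interval strictly between the two would have positive length. -/
theorem tch_of_touch {i j : Fin n} (hij : i < j) (h : S.Ψ i 1 = S.Ψ j 0) :
    S.Tch i ∧ j = S.suc i := by
  have hi : i ≠ S.l := (hij.trans_le (S.le_l j)).ne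
  have hs : S.suc i = j := by
    refine (S.suc_le hij).eq_or_lt.resolve_right fun hlt => ?_
    have h1 := S.Ψ_le_of_lt (S.suc_gt hi) (le_refl (1 : ℝ)) le_rfl
    have h2 := (S.Ψ_lt_iff (S.suc i)).2 one_pos
    have h3 := S.Ψ_le_of_lt hlt (le_refl (1 : ℝ)) le_rfl
    linarith
  exact ⟨⟨hi, by rw [hs]; exact h⟩, hs.symm⟩

theorem rew_one {i : Fin n} (hi : S.Tch i) : ∃ x, S.Rew i 1 x := by
  have := S.rew_left hi 0 S.one_mem_Z
  rwa [S.W_replicate_l_one] at this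

/-- Besides the disjointness of targets, the only danger is a touching point with its two addresses.
The address ending at `1` is always moved, so only the address with `0` remains. -/
theorem H_injective {j j' : Fin n} {y y' : ℝ} (hy : y ∈ S.T) (hy' : y' ∈ S.T)
    (h : S.H j y = S.H j' y') : j = j' ∧ y = y' := by
  have hlt : ∀ {j j' : Fin n} {y y' : ℝ}, y ∈ S.T → y' ∈ S.T → (∀ x, ¬ S.Rew j y x) → j < j' →
      S.Ψ j y ≠ S.Ψ j' y' := by
    intro j j' y y' hy hy' hj hlt he
    have h1 := S.Ψ_le_of_lt hlt (le_refl (1 : ℝ)) le_rfl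
    have h2 := (S.Ψ_le_iff j).2 (S.le_one hy)
    have h3 := (S.Ψ_le_iff j').2 (S.nonneg hy')
    have h4 : y = 1 := (S.Ψ_inj j).1 (by linarith)
    have h5 := (S.tch_of_touch hlt (by linarith)).1
    rw [h4] at hj
    obtain ⟨x, hx⟩ := S.rew_one h5
    exact hj x hx
  rcases S.H_cases j y with ⟨P, hP, hPj, z, hz, e, e1⟩ | ⟨hn, e1⟩ <;>
  rcases S.H_cases j' y' with ⟨P', hP', hPj', z', hz', e', e1'⟩ | ⟨hn', e1'⟩
  · have h2 := e1.trans (h.trans e1'.symm)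
    obtain rfl := S.tgt_unique hP hP' hz hz' h2
    rw [← e, ← e', (S.W_inj _).1 h2, ← hPj, ← hPj']
    exact ⟨rfl, rfl⟩
  · exact absurd (e1.trans (h.trans e1')) (S.tgt_ne_of_not_rew hP hz hy' hn')
  · exact absurd (e1'.trans (h.symm.trans e1)) (S.tgt_ne_of_not_rew hP' hz' hy hn)
  · rw [e1, e1'] at h
    rcases lt_trichotomy j j' with hl | rfl | hl
    · exact absurd h (hlt hy hy' hn hl)
    · exact ⟨rfl, (S.Ψ_inj j).1 h⟩
    · exact absurd h.symm (hlt hy' hy hn' hl)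

/-- Otherwise `z` lies in all the copies `l^{qk} Z`, which shrink to `1`. -/
theorem exists_shell {z : ℝ} (hz : z ∈ S.Z) (hz1 : z < 1) :
    ∃ k, ∃ z' ∈ S.Zshell, S.W (List.replicate (S.q * k) S.l) z' = z := by
  by_contra hcon
  push Not at hcon
  have key : ∀ k, ∃ z' ∈ S.Z, S.W (List.replicate (S.q * k) S.l) z' = z := by
    intro k
    induction k with
    | zero => exact ⟨z, hz, by simp⟩
    | succ k ih =>
      obtain ⟨z', hz', e⟩ := ih
      by_cases h : ∃ z'' ∈ S.Z, S.W (List.replicate S.q S.l) z'' = z'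
      · obtain ⟨z'', hz'', rfl⟩ := h
        refine ⟨z'', hz'', ?_⟩
        rw [mul_add, mul_one, ← List.replicate_append_replicate, S.W_append, e]
      · push Not at h
        exact absurd e (hcon k z' ⟨hz', h⟩)
  have hr1 : S.ρ S.l ^ S.q < 1 := pow_lt_one₀ (S.ρ_pos _).le (S.ρ_lt _) S.q_pos.ne'
  obtain ⟨k, hk⟩ := exists_pow_lt_of_lt_one (sub_pos.2 hz1) hr1
  obtain ⟨z', hz', e⟩ := key k
  have h1 := S.W_sub (List.replicate (S.q * k) S.l) 1 z'
  rw [e, S.W_replicate_l_one, R_replicate, pow_mul] at h1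
  have h2 := pow_pos (pow_pos (S.ρ_pos S.l) S.q) k
  have h3 := S.Z_pos hz'
  nlinarith

theorem H_surjective {x : ℝ} (hx : x ∈ S.T) : ∃ j, ∃ y ∈ S.T, S.H j y = x := by
  by_cases hP : ∃ P : Piece n, S.Tch P.base ∧ ∃ z ∈ S.dom P, S.W (S.tgt P) z = x
  · obtain ⟨P, hP, z, hz, rfl⟩ := hP
    exact ⟨S.letter P, _, S.W_mem _ (S.dom_subset hz).1, S.H_piece hP hz⟩
  · push Not at hP
    -- For a touching point the address in the right interval is taken, since the left one is moved
    -- away.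
    obtain ⟨j, y, hy, hnt, rfl⟩ :
        ∃ j, ∃ y ∈ S.T, (S.Tch j → y ≠ 1) ∧ S.Ψ j y = x := by
      obtain ⟨j, y, hy, e⟩ := S.exists_Ψ hx
      by_cases h : S.Tch j ∧ y = 1
      · refine ⟨S.suc j, 0, S.zero_mem, fun _ => zero_ne_one, ?_⟩
        rw [← h.1.2, ← e, h.2]
      · exact ⟨j, y, hy, fun h1 h2 => h ⟨h1, h2⟩, e⟩
    refine ⟨j, y, hy, S.H_of_not ?_⟩
    -- A position emptied by one piece is refilled by another: `i l^c Z` without its end by the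
    -- shells, level `0` by the first piece, level `k + 1` by the shift from level `k`.
    rintro x ⟨P, hPt, rfl, z, hz, rfl, rfl⟩
    have hz1 := S.Z_le_one (S.dom_subset hz)
    cases P with
    | first i =>
      have hz2 : z < 1 := lt_of_le_of_ne hz1 fun h =>
        hnt hPt (by rw [h]; exact S.W_replicate_l_one _)
      obtain ⟨k, z', hz', rfl⟩ := S.exists_shell hz hz2
      refine hP (.swap i k) hPt z' hz' ?_
      rw [src, ← S.W_append, List.replicate_append_replicate]; rfl
    | shift i k =>
      have hz' := S.W_replicate_l_mem_Z S.q hz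
      have e : S.W (S.src (.shift i k)) z =
          S.W (List.replicate (S.p * k) S.o ++ S.J i) (S.W (List.replicate S.q S.l) z) := by
        rw [← S.W_append, List.append_assoc]; rfl
      rw [e] at hP
      cases k with
      | zero => exact hP (.first i) hPt _ hz' rfl
      | succ k => exact hP (.shift i k) hPt _ hz' rfl
    | swap i k =>
      cases k with
      | zero => exact hP (.first i) hPt _ hz.1 rfl
      | succ k => exact hP (.shift i k) hPt _ hz.1 rfl

/-! ### Isolation and displacement of pieces; each rewired map is bi-Lipschitz -/

/-- The relative size of the isolating gaps around the pieces at a touching point. -/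
def isol (i : Fin n) : ℝ :=
  S.γ * (S.ρ i * S.ρ (S.suc i) * S.R (S.J i) * S.ρ S.l ^ S.c i * S.ρ S.l ^ S.q)

theorem isol_pos (i : Fin n) : 0 < S.isol i := by
  have h := S.ρ_pos
  have := S.R_pos (S.J i)
  have := S.γ_pos
  have := h i
  have := h (S.suc i)
  have := h S.l
  unfold isol
  positivity

/-- The scale of a piece. -/
def scale : Piece n → ℝ
  | .first _ => 1
  | .shift _ k => (S.ρ S.o ^ S.p) ^ k
  | .swap _ k => (S.ρ S.o ^ S.p) ^ k

theorem scale_pos (P : Piece n) : 0 < S.scale P := by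
  have := S.ρ_pos S.o
  cases P <;> simp only [scale] <;> positivity

/-- Copies of `Z` have the gap on their left; the ending `a l^f` supplies a gap on their right. -/
theorem iso_of_word (w : List (Fin n)) (f : ℕ) {z x : ℝ} (hz : z ∈ S.Z) (hx : x ∈ S.T)
    (hne : ∀ z' ∈ S.Z, S.W (w ++ S.a :: List.replicate f S.l) z' ≠ x) :
    S.γ * S.R (w ++ S.a :: List.replicate f S.l) ≤
      |S.W (w ++ S.a :: List.replicate f S.l) z - x| := by
  have hl := S.left_isolation (w ++ S.a :: List.replicate f S.l) hx
  have hr := S.right_isolation w f hx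
  set v := w ++ S.a :: List.replicate f S.l
  have h1 := (S.W_le_iff v).2 (S.Z_le_one hz)
  have h2 := (S.W_le_iff v).2 hz.2
  rw [le_abs]
  rcases hl with h | ⟨z', hz', e⟩ | h
  · left; linarith
  · exact absurd e (hne z' hz')
  · rcases hr with h' | h'
    · exact absurd (le_antisymm h h') (hne 1 S.one_mem_Z)
    · right; linarith

theorem J_eq_end {i : Fin n} (hi : S.Tch i) : ∃ v, ∀ f, S.J i ++ List.replicate f S.l =
    v ++ S.a :: List.replicate (S.d i + f) S.l := by
  obtain ⟨e, he⟩ := Nat.exists_eq_succ_of_ne_zero (S.d_pos i hi.1 hi.2).ne'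
  refine ⟨List.replicate (S.d i) S.o ++ i :: (List.replicate (S.d i - 1) (S.suc i) ++
    List.replicate e S.a), fun f => ?_⟩
  rw [← List.replicate_append_replicate]
  simp only [J, List.append_assoc, List.cons_append]
  rw [he, Nat.succ_eq_add_one, List.replicate_succ' (n := e) (a := S.a)]
  simp only [List.append_assoc, List.singleton_append]

theorem iso_run {i : Fin n} (hi : S.Tch i) (w : List (Fin n)) (f : ℕ) {z x : ℝ} (hz : z ∈ S.Z)
    (hx : x ∈ S.T) (hne : ∀ z' ∈ S.Z, S.W (w ++ (S.J i ++ List.replicate f S.l)) z' ≠ x) :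
    S.γ * (S.R w * (S.R (S.J i) * S.ρ S.l ^ f)) ≤
      |S.W (w ++ (S.J i ++ List.replicate f S.l)) z - x| := by
  obtain ⟨v, hv⟩ := S.J_eq_end hi
  have hR : S.R w * (S.R (S.J i) * S.ρ S.l ^ f) = S.R (w ++ (S.J i ++ List.replicate f S.l)) := by
    simp
  have e : w ++ (S.J i ++ List.replicate f S.l) =
      (w ++ v) ++ S.a :: List.replicate (S.d i + f) S.l := by
    rw [hv, List.append_assoc]
  rw [hR]
  rw [e] at hne ⊢
  exact S.iso_of_word _ _ hz hx hne

theorem factor_bounds (i : Fin n) :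
    (0 < S.ρ i ∧ S.ρ i ≤ 1) ∧ (0 < S.ρ (S.suc i) ∧ S.ρ (S.suc i) ≤ 1) ∧
    (0 < S.R (S.J i) ∧ S.R (S.J i) ≤ 1) ∧ (0 < S.ρ S.l ^ S.c i ∧ S.ρ S.l ^ S.c i ≤ 1) ∧
    (0 < S.ρ S.l ^ S.q ∧ S.ρ S.l ^ S.q ≤ 1) :=
  ⟨⟨S.ρ_pos _, (S.ρ_lt _).le⟩, ⟨S.ρ_pos _, (S.ρ_lt _).le⟩, ⟨S.R_pos _, S.R_le_one _⟩,
    ⟨pow_pos (S.ρ_pos _) _, pow_le_one₀ (S.ρ_pos _).le (S.ρ_lt _).le⟩,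
    ⟨pow_pos (S.ρ_pos _) _, pow_le_one₀ (S.ρ_pos _).le (S.ρ_lt _).le⟩⟩

/-- A product of some of the factors in `isol` bounds it. -/
theorem isol_le {i : Fin n} {r s : ℝ}
    (h : S.ρ i * S.ρ (S.suc i) * S.R (S.J i) * S.ρ S.l ^ S.c i * S.ρ S.l ^ S.q * s ≤ r) :
    S.isol i * s ≤ S.γ * r := by
  rw [isol, mul_assoc]
  exact mul_le_mul_of_nonneg_left h S.γ_pos.le

/-- The gaps at both ends of a copy of `Z` suffice, except that the first piece ends at `1`, beyond
which `T` has no points. For a shell, a point `x` in the inner copy is handled by the isolation of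
that copy, with the roles of the two points exchanged. -/
theorem src_iso {P : Piece n} (hP : S.Tch P.base) {z x : ℝ} (hz : z ∈ S.dom P) (hx : x ∈ S.T)
    (hne : ∀ z' ∈ S.dom P, S.W (S.src P) z' ≠ x) :
    S.isol P.base * S.scale P ≤ |S.W (S.src P) z - x| := by
  have hs := S.scale_pos P
  obtain ⟨⟨a0, a1⟩, ⟨b0, b1⟩, ⟨c0, c1⟩, ⟨d0, d1⟩, ⟨e0, e1⟩⟩ := S.factor_bounds P.base
  have shift : ∀ {i k}, S.Tch i → ∀ {z x : ℝ}, z ∈ S.Z → x ∈ S.T →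
      (∀ z' ∈ S.Z, S.W (S.src (.shift i k)) z' ≠ x) →
      S.isol i * S.scale (.shift i k) ≤ |S.W (S.src (.shift i k)) z - x| := by
    intro i k hi z x hz hx hne
    obtain ⟨⟨a0, a1⟩, ⟨b0, b1⟩, ⟨c0, c1⟩, ⟨d0, d1⟩, ⟨e0, e1⟩⟩ := S.factor_bounds i
    refine le_trans (S.isol_le ?_) (S.iso_run hi _ S.q hz hx hne)
    rw [R_replicate, pow_mul]
    change _ * (S.ρ S.o ^ S.p) ^ k ≤ _
    have h1 : S.ρ i * S.ρ (S.suc i) * S.ρ S.l ^ S.c i ≤ 1 :=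
      mul_le_one₀ (mul_le_one₀ a1 b0.le b1) d0.le d1
    have h2 := S.scale_pos (.shift i k)
    simp only [scale] at h2
    nlinarith [mul_pos (mul_pos c0 e0) h2]
  cases P with
  | first i =>
    refine le_trans (S.isol_le (r := S.R (S.src (.first i))) ?_) ?_
    · simp only [src, R_replicate, scale, Piece.base, mul_one] at *
      have h1 : S.ρ i * S.ρ (S.suc i) * S.R (S.J i) * S.ρ S.l ^ S.q ≤ 1 :=
        mul_le_one₀ (mul_le_one₀ (mul_le_one₀ a1 b0.le b1) c0.le c1) e0.le e1
      nlinarith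
    · rcases S.left_isolation (S.src (.first i)) hx with h | ⟨z', hz', e⟩ | h
      · rw [le_abs]
        left
        have := (S.W_le_iff (S.src (.first i))).2 (S.dom_subset hz).2
        linarith
      · exact absurd e (hne z' hz')
      · have h1 : S.W (S.src (.first i)) 1 = 1 := S.W_replicate_l_one _
        refine absurd ?_ (hne 1 S.one_mem_Z)
        rw [h1] at h ⊢
        exact le_antisymm h (S.le_one hx)
  | shift i k => exact shift hP hz hx hne
  | swap i k =>
    have e : ∀ z, S.W (S.src (.shift i k)) z =
        S.W (S.src (.swap i k)) (S.W (List.replicate S.q S.l) z) := by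
      intro z
      rw [← S.W_append, src, src, List.append_assoc]
    by_cases h : ∃ z' ∈ S.Z, S.W (S.src (.swap i k)) z' = x
    · obtain ⟨z', hz', rfl⟩ := h
      have h1 : z' ∉ S.Zshell := fun h => hne z' h rfl
      obtain ⟨z'', hz'', e''⟩ : ∃ z'' ∈ S.Z, S.W (List.replicate S.q S.l) z'' = z' := by
        by_contra hcon
        push Not at hcon
        exact h1 ⟨hz', hcon⟩
      rw [abs_sub_comm, ← e'', ← e]
      refine shift (i := i) hP hz'' (S.W_mem _ hz.1.1) fun u hu he => ?_
      rw [e, S.W_inj] at he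
      exact hz.2 u hu he
    · push Not at h
      have e2 : S.src (.swap i k) =
          List.replicate (S.p * k) S.o ++ (S.J i ++ List.replicate 0 S.l) := by simp [src]
      rw [e2] at h ⊢
      refine le_trans (S.isol_le ?_) (S.iso_run hP _ 0 hz.1 hx h)
      rw [R_replicate, pow_mul, pow_zero, mul_one]
      change _ * (S.ρ S.o ^ S.p) ^ k ≤ _
      have h1 : S.ρ i * S.ρ (S.suc i) * S.ρ S.l ^ S.c i * S.ρ S.l ^ S.q ≤ 1 :=
        mul_le_one₀ (mul_le_one₀ (mul_le_one₀ a1 b0.le b1) d0.le d1) e0.le e1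
      simp only [scale, Piece.base] at hs c0 ⊢
      nlinarith [mul_pos c0 hs]

/-- Targets on the right of a touching point end in `a l^d` and are isolated on both sides. A shell
moved to the left of it is separated from everything to its right by the gap before the inner copy
`l^q Z`. -/
theorem tgt_iso {P : Piece n} (hP : S.Tch P.base) {z x : ℝ} (hz : z ∈ S.dom P) (hx : x ∈ S.T)
    (hne : ∀ z' ∈ S.dom P, S.W (S.tgt P) z' ≠ x) :
    S.isol P.base * S.scale P ≤ |S.W (S.tgt P) z - x| := by
  have hs := S.scale_pos P
  obtain ⟨⟨a0, a1⟩, ⟨b0, b1⟩, ⟨c0, c1⟩, ⟨d0, d1⟩, ⟨e0, e1⟩⟩ := S.factor_bounds P.base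
  have key : ∀ {i : Fin n}, S.Tch i → ∀ {m : ℕ} {s : ℝ}, 0 < s → s * S.ρ S.l ^ S.q ≤ S.ρ S.o ^ m →
      z ∈ S.Z → (∀ z' ∈ S.Z, S.W (S.suc i :: (List.replicate m S.o ++ S.J i)) z' ≠ x) →
      S.isol i * s ≤ |S.W (S.suc i :: (List.replicate m S.o ++ S.J i)) z - x| := by
    intro i hi m s hs hsm hz hne
    obtain ⟨⟨a0, a1⟩, ⟨b0, b1⟩, ⟨c0, c1⟩, ⟨d0, d1⟩, ⟨e0, e1⟩⟩ := S.factor_bounds i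
    have e2 : S.suc i :: (List.replicate m S.o ++ S.J i) =
        (S.suc i :: List.replicate m S.o) ++ (S.J i ++ List.replicate 0 S.l) := by simp
    rw [e2] at hne ⊢
    refine le_trans (S.isol_le ?_) (S.iso_run hi _ 0 hz hx hne)
    rw [R_cons, R_replicate, pow_zero, mul_one]
    have h1 : S.ρ i * S.ρ S.l ^ S.c i ≤ 1 := mul_le_one₀ a1 d0.le d1
    have h2 : 0 < S.ρ (S.suc i) * S.R (S.J i) := mul_pos b0 c0
    calc _ = (S.ρ i * S.ρ S.l ^ S.c i) *
          ((S.ρ (S.suc i) * S.R (S.J i)) * (s * S.ρ S.l ^ S.q)) := by ring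
      _ ≤ (S.ρ (S.suc i) * S.R (S.J i)) * (s * S.ρ S.l ^ S.q) :=
          mul_le_of_le_one_left (by positivity) h1
      _ ≤ (S.ρ (S.suc i) * S.R (S.J i)) * S.ρ S.o ^ m := mul_le_mul_of_nonneg_left hsm h2.le
      _ = _ := by ring
  cases P with
  | first i =>
    refine key hP hs ?_ hz hne
    simpa [scale] using e1
  | shift i k =>
    refine key hP hs ?_ hz hne
    rw [scale, pow_mul, pow_succ, ← S.pow_eq]
  | swap i k =>
    have e : ∀ z, S.W (S.tgt (.swap i k) ++ List.replicate S.q S.l) z =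
        S.W (S.tgt (.swap i k)) (S.W (List.replicate S.q S.l) z) := fun z => S.W_append _ _ _
    set v := S.tgt (.swap i k) with hv
    set v' := v ++ List.replicate S.q S.l with hv'
    have hRv : S.R v = S.ρ i * (S.ρ S.l ^ S.c i * (S.ρ S.o ^ S.p) ^ k) := by
      rw [hv, tgt, R_cons, R_replicate, pow_add, pow_mul, S.pow_eq]
    have hRv' : S.R v' = S.R v * S.ρ S.l ^ S.q := by rw [hv', R_append, R_replicate]
    have hle : S.isol i * S.scale (.swap i k) ≤ S.γ * S.R v' := by
      refine S.isol_le ?_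
      rw [hRv', hRv]
      have h1 : S.ρ (S.suc i) * S.R (S.J i) ≤ 1 := mul_le_one₀ b1 c0.le c1
      simp only [scale, Piece.base] at *
      calc _ = (S.ρ (S.suc i) * S.R (S.J i)) * (S.ρ i * (S.ρ S.l ^ S.c i *
            (S.ρ S.o ^ S.p) ^ k) * S.ρ S.l ^ S.q) := by ring
        _ ≤ _ := mul_le_of_le_one_left (by positivity) h1
    have hzl : S.W v z ≤ S.W v' S.ζ - S.γ * S.R v' := by
      rcases S.left_isolation v' (S.W_mem v hz.1.1) with h | ⟨z', hz', h⟩ | h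
      · exact h
      · rw [e, S.W_inj] at h
        exact absurd h (hz.2 z' hz')
      · rw [e, S.W_replicate_l_one, S.W_le_iff] at h
        exact absurd h (not_le.2 (S.Zshell_ne_one hz))
    refine hle.trans ?_
    rw [le_abs]
    rcases S.left_isolation v hx with h | ⟨z', hz', rfl⟩ | h
    · left
      have h1 := (S.W_le_iff v).2 hz.1.2
      have h2 : S.R v' ≤ S.R v := by
        rw [hRv']; exact mul_le_of_le_one_right (S.R_pos v).le e1
      have h3 := mul_le_mul_of_nonneg_left h2 S.γ_pos.le
      linarith
    · right
      have h1 : z' ∉ S.Zshell := fun h => hne z' h rfl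
      obtain ⟨z'', hz'', rfl⟩ : ∃ z'' ∈ S.Z, S.W (List.replicate S.q S.l) z'' = z' := by
        by_contra hcon
        push Not at hcon
        exact h1 ⟨hz', hcon⟩
      rw [← e]
      have := (S.W_le_iff v').2 hz''.2
      linarith
    · right
      have h1 : S.W v' S.ζ ≤ S.W v 1 := by
        rw [e]; exact (S.W_le_iff v).2 (S.W_le_one _ (S.Z_le_one ⟨S.Ψ_mem S.zero_mem, le_rfl⟩))
      linarith

/-- A shifted piece stays in the cylinder `(suc i) o^{pk}`; a swapped shell jumps across the
touching point, to which source and target are both within `scale` because `ρ_o^p = ρ_l^q`. -/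
theorem displacement {P : Piece n} (hP : S.Tch P.base) {z : ℝ} (hz : z ∈ S.dom P) :
    |S.W (S.tgt P) z - S.Ψ (S.letter P) (S.W (S.src P) z)| ≤ 2 * S.scale P := by
  have hs := S.scale_pos P
  have hz0 := (S.Z_pos (S.dom_subset hz)).le
  have hz1 := S.Z_le_one (S.dom_subset hz)
  have bound : ∀ (j : Fin n) (k : ℕ) (x y : ℝ), 0 ≤ x → x ≤ 1 → 0 ≤ y → y ≤ 1 →
      |S.Ψ j (S.W (List.replicate (S.p * k) S.o) x) - S.Ψ j (S.W (List.replicate (S.p * k) S.o) y)|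
        ≤ (S.ρ S.o ^ S.p) ^ k := by
    intro j k x y hx hx1 hy hy1
    have h1 := S.ρ_pos j
    have h2 : 0 < (S.ρ S.o ^ S.p) ^ k := pow_pos (pow_pos (S.ρ_pos _) _) _
    rw [Ψ_sub, W_sub, R_replicate, pow_mul, abs_mul, abs_mul, abs_of_pos h1, abs_of_pos h2]
    have h3 : |x - y| ≤ 1 := abs_sub_le_iff.2 ⟨by linarith, by linarith⟩
    calc _ ≤ 1 * ((S.ρ S.o ^ S.p) ^ k * 1) := by
          gcongr
          exact (S.ρ_lt j).le
      _ = _ := by ring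
  cases P with
  | first i =>
    have h1 := S.W_nonneg (S.tgt (.first i)) hz0
    have h2 := S.W_le_one (S.tgt (.first i)) hz1
    have h3 := S.Ψ_nonneg (S.letter (.first i)) (S.W_nonneg (S.src (.first i)) hz0)
    have h4 := S.Ψ_le_one (S.letter (.first i)) (S.W_le_one (S.src (.first i)) hz1)
    simp only [scale]
    exact abs_sub_le_iff.2 ⟨by linarith, by linarith⟩
  | shift i k =>
    rw [tgt, letter, src, W_cons, mul_add, ← List.replicate_append_replicate, List.append_assoc,
      S.W_append, S.W_append (List.replicate (S.p * k) S.o)]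
    refine (bound _ _ _ _ (S.W_nonneg _ hz0) (S.W_le_one _ hz1) (S.W_nonneg _ hz0)
      (S.W_le_one _ hz1)).trans ?_
    simp only [scale] at *
    linarith
  | swap i k =>
    have h1 := bound (S.suc i) k (S.W (S.J i) z) 0 (S.W_nonneg _ hz0) (S.W_le_one _ hz1) le_rfl
      zero_le_one
    rw [S.W_replicate_o_zero, ← (show S.Tch i from hP).2, ← S.W_append] at h1
    have h2 := S.W_sub (S.tgt (.swap i k)) z 1
    have h3 : S.W (S.tgt (.swap i k)) 1 = S.Ψ i 1 := by
      rw [tgt, W_cons, S.W_replicate_l_one]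
    have h4 : S.R (S.tgt (.swap i k)) ≤ S.scale (.swap i k) := by
      rw [tgt, R_cons, R_replicate, pow_add, pow_mul, scale, S.pow_eq]
      have a1 := S.factor_bounds i
      have : 0 < (S.ρ S.l ^ S.q) ^ k := pow_pos a1.2.2.2.2.1 _
      rw [← mul_assoc]
      exact mul_le_of_le_one_left this.le (mul_le_one₀ a1.1.2 a1.2.2.2.1.1.le a1.2.2.2.1.2)
    have h5 : |S.W (S.tgt (.swap i k)) z - S.Ψ i 1| ≤ S.scale (.swap i k) := by
      rw [← h3, h2, abs_mul, abs_of_pos (S.R_pos _)]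
      have h6 : |z - 1| ≤ 1 := abs_sub_le_iff.2 ⟨by linarith, by linarith⟩
      calc _ ≤ S.scale (.swap i k) * 1 := by gcongr
        _ = _ := mul_one _
    have h6 := abs_sub_le (S.W (S.tgt (.swap i k)) z) (S.Ψ i 1)
      (S.Ψ (S.suc i) (S.W (S.src (.swap i k)) z))
    rw [abs_sub_comm (S.Ψ i 1)] at h6
    simp only [src, letter, scale, Piece.base] at *
    linarith

theorem exists_isol : ∃ ε, 0 < ε ∧ ∀ i, ε ≤ S.isol i := by
  have : Nonempty (Fin n) := ⟨S.o⟩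
  obtain ⟨i, hi⟩ := Finite.exists_min S.isol
  exact ⟨S.isol i, S.isol_pos i, hi⟩

theorem H_same_piece {P : Piece n} (hP : S.Tch P.base) {z z' : ℝ} (hz : z ∈ S.dom P)
    (hz' : z' ∈ S.dom P) : S.H (S.letter P) (S.W (S.src P) z) - S.H (S.letter P) (S.W (S.src P) z')
      = S.ρ (S.letter P) * (S.W (S.src P) z - S.W (S.src P) z') := by
  rw [S.H_piece hP hz, S.H_piece hP hz', W_sub, W_sub, S.ratio_tgt hP, mul_assoc]

/-- Two points either move together or are as far apart, before and after, as a multiple of the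
scale bounding both displacements. For two distinct pieces this is the larger of their scales. -/
theorem H_dichotomy {ε : ℝ} (hε : ∀ i, ε ≤ S.isol i) (j : Fin n) {y y' : ℝ} (hy : y ∈ S.T)
    (hy' : y' ∈ S.T) : S.H j y - S.H j y' = S.ρ j * (y - y') ∨
      ∃ s, |S.H j y - S.Ψ j y| ≤ 2 * s ∧ |S.H j y' - S.Ψ j y'| ≤ 2 * s ∧
        ε * s ≤ |y - y'| ∧ ε * s ≤ |S.H j y - S.H j y'| := by
  have one : ∀ {P : Piece n}, S.Tch P.base → S.letter P = j → ∀ {z}, z ∈ S.dom P →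
      ∀ {y'}, y' ∈ S.T → (∀ z' ∈ S.dom P, S.W (S.src P) z' ≠ y') →
      (∀ z' ∈ S.dom P, S.W (S.tgt P) z' ≠ S.H j y') →
      |S.W (S.tgt P) z - S.Ψ j (S.W (S.src P) z)| ≤ 2 * S.scale P ∧
      ε * S.scale P ≤ |S.W (S.src P) z - y'| ∧ ε * S.scale P ≤ |S.W (S.tgt P) z - S.H j y'| := by
    rintro P hP rfl z hz y' hy' h1 h2
    have h3 := mul_le_mul_of_nonneg_right (hε P.base) (S.scale_pos P).le
    exact ⟨S.displacement hP hz, h3.trans (S.src_iso hP hz hy' h1),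
      h3.trans (S.tgt_iso hP hz (S.H_mem hy') h2)⟩
  have mixed : ∀ {P : Piece n}, S.Tch P.base → S.letter P = j → ∀ {z}, z ∈ S.dom P →
      ∀ {y'}, y' ∈ S.T → (∀ x, ¬ S.Rew j y' x) → S.H j y' = S.Ψ j y' →
      |S.W (S.tgt P) z - S.Ψ j (S.W (S.src P) z)| ≤ 2 * S.scale P ∧
      ε * S.scale P ≤ |S.W (S.src P) z - y'| ∧ ε * S.scale P ≤ |S.W (S.tgt P) z - S.H j y'| := by
    intro P hP hPj z hz y' hy' hn e'
    refine one hP hPj hz hy' (fun z' hz' h => hn _ ⟨P, hP, hPj, z', hz', h, rfl⟩)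
      fun z' hz' h => S.tgt_ne_of_not_rew hP hz' hy' hn (h.trans e')
  rcases S.H_cases j y with ⟨P, hP, hPj, z, hz, e, e1⟩ | ⟨hn, e1⟩ <;>
  rcases S.H_cases j y' with ⟨P', hP', hPj', z', hz', e', e1'⟩ | ⟨hn', e1'⟩
  · by_cases hPP : P = P'
    · subst hPP
      subst hPj
      left
      rw [← e, ← e']
      exact S.H_same_piece hP hz hz'
    · right
      have h1 := one hP hPj hz hy'
        (fun u hu h => hPP (S.src_unique hP hP' (hPj.trans hPj'.symm) hu hz' (h.trans e'.symm)))
        (fun u hu h => hPP (S.tgt_unique hP hP' hu hz' (h.trans e1'.symm)))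
      have h2 := one hP' hPj' hz' hy
        (fun u hu h => hPP (S.src_unique hP hP' (hPj.trans hPj'.symm) hz hu (e.trans h.symm)))
        (fun u hu h => hPP (S.tgt_unique hP hP' hz hu (e1.trans h.symm)))
      rw [e, e1] at h1
      rw [e', e1', abs_sub_comm y', abs_sub_comm (S.H j y') (S.H j y)] at h2
      rcases le_total (S.scale P) (S.scale P') with h | h
      · exact ⟨S.scale P', h1.1.trans (by linarith), h2.1, h2.2.1, h2.2.2⟩
      · exact ⟨S.scale P, h1.1, h2.1.trans (by linarith), h1.2.1, h1.2.2⟩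
  · right
    have h1 := mixed hP hPj hz hy' hn' e1'
    rw [e, e1] at h1
    refine ⟨S.scale P, h1.1, ?_, h1.2.1, h1.2.2⟩
    rw [e1', sub_self, abs_zero]
    exact (mul_pos two_pos (S.scale_pos P)).le
  · right
    have h1 := mixed hP' hPj' hz' hy hn e1
    rw [e', e1', abs_sub_comm y', abs_sub_comm (S.H j y') (S.H j y)] at h1
    refine ⟨S.scale P', ?_, h1.1, h1.2.1, h1.2.2⟩
    rw [e1, sub_self, abs_zero]
    exact (mul_pos two_pos (S.scale_pos P')).le
  · left
    rw [e1, e1', Ψ_sub]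

/-- On the attractor, `f` multiplies distances by `r`, up to the factor `K`. -/
def BiLip (K r : ℝ) (f : ℝ → ℝ) : Prop := ∀ x ∈ S.T, ∀ y ∈ S.T,
  r * |x - y| ≤ K * |f x - f y| ∧ |f x - f y| ≤ K * (r * |x - y|)

/-- Each map of the rewired system is bi-Lipschitz. -/
theorem exists_biLip_H : ∃ K, 1 ≤ K ∧ ∀ j, S.BiLip K (S.ρ j) (S.H j) := by
  obtain ⟨ε, hε0, hε⟩ := S.exists_isol
  have : Nonempty (Fin n) := ⟨S.o⟩
  obtain ⟨i₀, hi₀⟩ := Finite.exists_min S.ρ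
  set m := S.ρ i₀ with hm
  have hm0 : 0 < m := S.ρ_pos i₀
  have hm1 : m < 1 := S.ρ_lt i₀
  -- The two displacements total at most `4 s`, and `s` is at most the distance divided by `ε`; the
  -- factor `m` allows comparison with `ρ_j |y - y'|`.
  have hL0 : 0 < 4 / (ε * m) := by positivity
  have hL : 4 / (ε * m) * (ε * m) = 4 := div_mul_cancel₀ _ (by positivity)
  set L := 4 / (ε * m)
  refine ⟨1 + L, by linarith, fun j y hy y' hy' => ?_⟩
  have hj := S.ρ_pos j
  have hA := abs_nonneg (y - y')
  have hB := abs_nonneg (S.H j y - S.H j y')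
  rcases S.H_dichotomy hε j hy hy' with h | ⟨s, h1, h2, h3, h4⟩
  · rw [h, abs_mul, abs_of_pos hj]
    have : 0 ≤ S.ρ j * |y - y'| := by positivity
    constructor <;> nlinarith
  · have e : S.ρ j * |y - y'| = |S.Ψ j y - S.Ψ j y'| := by rw [Ψ_sub, abs_mul, abs_of_pos hj]
    have t1 : |S.H j y - S.H j y'| ≤ S.ρ j * |y - y'| + 4 * s := by
      rw [e]
      have := abs_sub_le_iff.1 h1
      have := abs_sub_le_iff.1 h2
      have hh := abs_sub_le_iff.1 (le_refl |S.Ψ j y - S.Ψ j y'|)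
      exact abs_sub_le_iff.2 ⟨by linarith [hh.1], by linarith [hh.2]⟩
    have t2 : S.ρ j * |y - y'| ≤ |S.H j y - S.H j y'| + 4 * s := by
      rw [e]
      have := abs_sub_le_iff.1 h1
      have := abs_sub_le_iff.1 h2
      have hh := abs_sub_le_iff.1 (le_refl |S.H j y - S.H j y'|)
      exact abs_sub_le_iff.2 ⟨by linarith [hh.1], by linarith [hh.2]⟩
    have t3 : 4 * s ≤ L * (m * |y - y'|) := by
      have := mul_le_mul_of_nonneg_left h3 (mul_pos hL0 hm0).le
      calc 4 * s = L * (ε * m) * s := by rw [hL]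
        _ = L * m * (ε * s) := by ring
        _ ≤ _ := by linarith
    have t4 : 4 * s ≤ L * |S.H j y - S.H j y'| := by
      have h5 := mul_le_mul_of_nonneg_left h4 (mul_pos hL0 hm0).le
      have h6 : L * m * |S.H j y - S.H j y'| ≤ L * |S.H j y - S.H j y'| := by
        apply mul_le_mul_of_nonneg_right _ hB
        exact mul_le_of_le_one_right hL0.le hm1.le
      calc 4 * s = L * (ε * m) * s := by rw [hL]
        _ = L * m * (ε * s) := by ring
        _ ≤ _ := by linarith
    constructor
    · linarith
    · have : L * (m * |y - y'|) ≤ L * (S.ρ j * |y - y'|) := by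
        gcongr
        exact hi₀ j
      linarith

/-! ### Compositions of the rewired maps -/

/-- The compositions of the maps of the rewired system. -/
noncomputable def Hw : List (Fin n) → ℝ → ℝ := wordMap S.H

@[simp] theorem Hw_nil (x : ℝ) : S.Hw [] x = x := rfl

@[simp] theorem Hw_cons (j : Fin n) (w : List (Fin n)) (x : ℝ) :
    S.Hw (j :: w) x = S.H j (S.Hw w x) := rfl

theorem Hw_append (u v : List (Fin n)) (x : ℝ) : S.Hw (u ++ v) x = S.Hw u (S.Hw v x) :=
  wordMap_append _ _ _ _

theorem Hw_mem (w : List (Fin n)) {x : ℝ} (hx : x ∈ S.T) : S.Hw w x ∈ S.T :=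
  wordMap_mem (fun _ _ h => S.H_mem h) w hx

/-- At each level the shift and swap sources together lie in one copy of `Z`, so it is enough to
avoid these copies. -/
theorem H_eq_Ψ {j : Fin n} {y : ℝ}
    (hL : S.Tch j → ∀ z ∈ S.Z, S.W (List.replicate (S.c j) S.l) z ≠ y)
    (hR : ∀ i, S.Tch i → S.suc i = j → ∀ k, ∀ z ∈ S.Z,
      S.W (List.replicate (S.p * k) S.o ++ S.J i) z ≠ y) : S.H j y = S.Ψ j y := by
  refine S.H_of_not ?_
  rintro x ⟨P, hP, rfl, z, hz, e, -⟩
  cases P with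
  | first i => exact hL hP z hz e
  | shift i k =>
    refine hR i hP rfl k _ (S.W_replicate_l_mem_Z S.q hz) ?_
    rw [← S.W_append, List.append_assoc]
    exact e
  | swap i k => exact hR i hP rfl k z hz.1 e

/-- A word starting with `l` leads to no point of an interval other than the last one. -/
theorem W_replicate_l_ne {i : Fin n} (hi : S.Tch i) {g : Fin n} (hg : g ≠ S.l)
    {s : List (Fin n)} {z z' : ℝ} (hz : z ∈ S.Z) (hz' : z' ∈ S.Z) :
    S.W (List.replicate (S.c i) S.l) z ≠ S.W (g :: s) z' := by
  intro h
  obtain ⟨m, hm⟩ := S.src_first hi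
  rw [hm] at h
  exact hg (S.W_head (S.Z_pos hz) (S.Z_le_one hz) (S.Z_pos hz') (S.Z_le_one hz') h).1.symm

theorem W_run_ne {i : Fin n} (hi : S.Tch i) (m : ℕ) {g : Fin n} (hg : g ≠ S.o)
    {s : List (Fin n)} {z z' : ℝ} (hz : z ∈ S.Z) (hz' : z' ∈ S.Z) :
    S.W (List.replicate m S.o ++ S.J i) z ≠ S.W (g :: s) z' := by
  intro h
  obtain ⟨u, hu⟩ := S.exists_run_J_eq hi m []
  rw [List.append_nil] at hu
  rw [hu] at h
  exact hg (S.W_head (S.Z_pos hz) (S.Z_le_one hz) (S.Z_pos hz') (S.Z_le_one hz') h).1.symm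

/-- When `a = o` first letters no longer distinguish the words; the letter ending the run of `o`
does, being `i` on one side and `l` on the other. -/
theorem W_run_ne_run_l (ha : S.a = S.o) {i : Fin n} (hi : S.Tch i) (m m' : ℕ)
    {s : List (Fin n)} {z z' : ℝ} (hz : z ∈ S.Z) (hz' : z' ∈ S.Z) :
    S.W (List.replicate m S.o ++ S.J i) z ≠ S.W (List.replicate m' S.o ++ S.l :: s) z' := by
  intro h
  have hio : i ≠ S.o := fun h => S.not_tch_a (by rw [ha, ← h]; exact hi)
  rw [J, ← List.append_assoc, List.replicate_append_replicate] at h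
  exact hi.1 (S.run_unique hio S.o_ne_l.symm (S.Z_pos hz) (S.Z_le_one hz) (S.Z_pos hz')
    (S.Z_le_one hz') h).2.1

/-- In the interval `l` the sources start with `o`, whereas the points met here start with `l` or
lie in `Z`, which no cylinder of `o` meets. -/
theorem Hw_replicate_l (f : ℕ) {z : ℝ} (hz : z ∈ S.Z) :
    S.Hw (List.replicate f S.l) z = S.W (List.replicate f S.l) z := by
  induction f with
  | zero => rfl
  | succ f ih =>
    rw [List.replicate_succ, Hw_cons, W_cons, ih]
    refine S.H_eq_Ψ (fun h => absurd rfl h.1) fun i hi _ k z' hz' => ?_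
    cases f with
    | zero =>
      intro h
      obtain ⟨u, hu⟩ := S.exists_run_J_eq hi (S.p * k) []
      rw [List.append_nil] at hu
      rw [hu, W_cons] at h
      exact S.Ψ_notMem_Z (S.o_le _) (S.W_le_one u (S.Z_le_one hz')) (h ▸ hz)
    | succ f => exact S.W_run_ne hi _ S.o_ne_l.symm hz' hz

theorem Hw_replicate_a (e f : ℕ) {z : ℝ} (hz : z ∈ S.Z) :
    S.Hw (List.replicate e S.a ++ List.replicate (f + 1) S.l) z =
      S.W (List.replicate e S.a ++ List.replicate (f + 1) S.l) z := by
  induction e with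
  | zero => exact S.Hw_replicate_l _ hz
  | succ e ih =>
    rw [List.replicate_succ, List.cons_append, Hw_cons, W_cons, ih]
    refine S.H_eq_Ψ (fun h => absurd h S.not_tch_a) fun i hi hs k z' hz' => ?_
    cases e with
    | zero => exact S.W_run_ne hi _ S.o_ne_l.symm hz' hz
    | succ e => exact S.W_run_ne hi _ (hs ▸ S.suc_ne_o hi.1) hz' hz

theorem W_run_ne_a {i : Fin n} (hi : S.Tch i) (m e f : ℕ) {z z' : ℝ} (hz : z ∈ S.Z)
    (hz' : z' ∈ S.Z) : S.W (List.replicate m S.o ++ S.J i) z ≠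
      S.W (List.replicate (e + 1) S.a ++ List.replicate (f + 1) S.l) z' := by
  by_cases ha : S.a = S.o
  · rw [ha]
    exact S.W_run_ne_run_l ha hi m (e + 1) hz hz'
  · exact S.W_run_ne hi m ha hz hz'

theorem Hw_replicate_suc {i : Fin n} (hi : S.Tch i) (r e f : ℕ) {z : ℝ} (hz : z ∈ S.Z) :
    S.Hw (List.replicate r (S.suc i) ++ (List.replicate (e + 1) S.a ++ List.replicate (f + 1) S.l)) z
      = S.W (List.replicate r (S.suc i) ++
        (List.replicate (e + 1) S.a ++ List.replicate (f + 1) S.l)) z := by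
  induction r with
  | zero => exact S.Hw_replicate_a _ _ hz
  | succ r ih =>
    rw [List.replicate_succ, List.cons_append, Hw_cons, W_cons, ih]
    refine S.H_eq_Ψ (fun h z' hz' => ?_) fun i' hi' _ k z' hz' => ?_
    · cases r with
      | zero => exact S.W_replicate_l_ne h S.a_ne hz' hz
      | succ r => exact S.W_replicate_l_ne h h.1 hz' hz
    · cases r with
      | zero => exact S.W_run_ne_a hi' _ e f hz' hz
      | succ r => exact S.W_run_ne hi' _ (S.suc_ne_o hi.1) hz' hz

theorem Hw_middle {i : Fin n} (hi : S.Tch i) {e : ℕ} (he : e < S.c i) (f : ℕ) {z : ℝ}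
    (hz : z ∈ S.Z) :
    S.Hw (i :: (List.replicate e (S.suc i) ++
      (List.replicate (e + 1) S.a ++ List.replicate (f + 1) S.l))) z =
    S.W (i :: (List.replicate e (S.suc i) ++
      (List.replicate (e + 1) S.a ++ List.replicate (f + 1) S.l))) z := by
  rw [Hw_cons, W_cons, S.Hw_replicate_suc hi _ _ _ hz]
  refine S.H_eq_Ψ (fun _ z' hz' => ?_) fun i' hi' _ k z' hz' => ?_
  -- If `suc i = l`, the run of `l` has length `e < c` and is followed by `a`, hence cannot start
  -- with `l^c`.
  · by_cases hs : S.suc i = S.l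
    · intro h
      obtain ⟨r, hr⟩ := Nat.exists_eq_add_of_lt he
      rw [hs, hr, add_assoc, S.W_replicate_add, S.W_append, S.W_inj] at h
      exact S.a_ne (S.W_head (S.Z_pos hz') (S.Z_le_one hz') (S.Z_pos hz) (S.Z_le_one hz) h).1.symm
    · cases e with
      | zero => exact S.W_replicate_l_ne hi S.a_ne hz' hz
      | succ e => exact S.W_replicate_l_ne hi hs hz' hz
  · cases e with
    | zero => exact S.W_run_ne_a hi' _ 0 f hz' hz
    | succ e => exact S.W_run_ne hi' _ (S.suc_ne_o hi.1) hz' hz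

/-- Along the words of the pieces the rewired system agrees with the original one. -/
theorem Hw_run {i : Fin n} (hi : S.Tch i) (m f : ℕ) {z : ℝ} (hz : z ∈ S.Z) :
    S.Hw (List.replicate m S.o ++ (S.J i ++ List.replicate f S.l)) z =
      S.W (List.replicate m S.o ++ (S.J i ++ List.replicate f S.l)) z := by
  obtain ⟨e, he⟩ := Nat.exists_eq_succ_of_ne_zero (S.d_pos i hi.1 hi.2).ne'
  have hec : e < S.c i := by have := S.d_lt_c i hi.1 hi.2; omega
  have hJ : List.replicate m S.o ++ (S.J i ++ List.replicate f S.l) =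
      List.replicate (m + (e + 1)) S.o ++ (i :: (List.replicate e (S.suc i) ++
        (List.replicate (e + 1) S.a ++ List.replicate (e + f + 1) S.l))) := by
    have : e + f + 1 = (e + 1) + f := by ring
    rw [J, he, this, ← List.replicate_append_replicate, ← List.replicate_append_replicate (n := e + 1)]
    simp only [List.append_assoc, List.cons_append, Nat.succ_eq_add_one, Nat.add_sub_cancel]
  rw [hJ]
  generalize m + (e + 1) = M
  induction M with
  | zero => exact S.Hw_middle hi hec _ hz
  | succ M ih =>
    rw [List.replicate_succ, List.cons_append, Hw_cons, W_cons, ih]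
    refine S.H_eq_Ψ (fun h z' hz' => ?_) fun i' hi' hs => absurd hs (S.suc_ne_o hi'.1)
    cases M with
    | zero => exact S.W_replicate_l_ne h hi.1 hz' hz
    | succ M => exact S.W_replicate_l_ne h h.1 hz' hz

theorem Hw_src {P : Piece n} (hP : S.Tch P.base) {z : ℝ} (hz : z ∈ S.Z) :
    S.Hw (S.src P) z = S.W (S.src P) z := by
  cases P with
  | first i => exact S.Hw_replicate_l _ hz
  | shift i k => exact S.Hw_run hP _ _ hz
  | swap i k => simpa [src] using S.Hw_run (i := i) hP (S.p * k) 0 hz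

theorem Ψ_mem_Z_iff {g : Fin n} {x : ℝ} (hx : x ∈ S.T) : S.Ψ g x ∈ S.Z ↔ S.a < g :=
  ⟨fun h => not_le.1 fun hle => S.Ψ_notMem_Z hle (S.le_one hx) h, fun h => S.Ψ_mem_Z h hx⟩

theorem a_lt_suc_iff {i : Fin n} (hi : S.Tch i) : S.a < S.suc i ↔ S.a < i := by
  refine ⟨fun h => ?_, fun h => h.trans (S.suc_gt hi.1)⟩
  have hne : S.a ≠ i := fun h => S.not_tch_a (h ▸ hi)
  refine lt_of_le_of_ne (not_lt.1 fun hlt => ?_) hne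
  exact absurd (S.suc_le hlt) (not_le.2 h)

/-- Pieces only move between touching neighbours, which the gap never separates. Thus `Z` is also a
union of first-level cylinders of the rewired system. -/
theorem H_mem_Z_iff {b : Fin n} {y : ℝ} (hy : y ∈ S.T) : S.H b y ∈ S.Z ↔ S.a < b := by
  rcases S.H_cases b y with ⟨P, hP, rfl, z, hz, -, e⟩ | ⟨-, e⟩
  · have hzT := (S.dom_subset hz).1
    rw [← e]
    cases P with
    | first i => exact (S.Ψ_mem_Z_iff (S.W_mem _ hzT)).trans (S.a_lt_suc_iff hP)
    | shift i k => exact S.Ψ_mem_Z_iff (S.W_mem _ hzT)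
    | swap i k => exact (S.Ψ_mem_Z_iff (S.W_mem _ hzT)).trans (S.a_lt_suc_iff hP).symm
  · rw [e]; exact S.Ψ_mem_Z_iff hy

theorem Hw_parse {w u : List (Fin n)} {x y : ℝ} (hx : x ∈ S.T) (hy : y ∈ S.T)
    (h : S.Hw w x = S.Hw u y) : w <+: u ∨ ∃ v, w = u ++ v ∧ y = S.Hw v x := by
  induction u generalizing w with
  | nil => exact Or.inr ⟨w, rfl, h.symm⟩
  | cons j u ih =>
    cases w with
    | nil => exact Or.inl List.nil_prefix
    | cons i w =>
      obtain ⟨rfl, h2⟩ := S.H_injective (S.Hw_mem w hx) (S.Hw_mem u hy) h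
      rcases ih h2 with h3 | ⟨v, rfl, h3⟩
      · exact Or.inl ((List.prefix_cons_inj i).2 h3)
      · exact Or.inr ⟨v, rfl, h3⟩

/-- A cylinder of the rewired system lies inside or outside a piece, unless its word is a prefix of
the word of the piece. -/
theorem all_or_nothing {w u : List (Fin n)} (hu : ∀ z ∈ S.Z, S.Hw u z = S.W u z)
    (hw : ∀ b, ¬ w <+: u ++ [b]) {x : ℝ} (hx : x ∈ S.T) (h : ∃ z ∈ S.Z, S.W u z = S.Hw w x)
    {y : ℝ} (hy : y ∈ S.T) : ∃ z ∈ S.Z, S.W u z = S.Hw w y := by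
  obtain ⟨z, hz, e⟩ := h
  -- The common point lies in the rewired cylinder of `u b` with `b` beyond the gap; as `w` is no
  -- prefix of `u b`, it extends it, so the whole cylinder of `w` lies in the piece.
  obtain ⟨b, z', hz', rfl⟩ := S.H_surjective hz.1
  have hb := (S.H_mem_Z_iff hz').1 hz
  have e2 : S.Hw w x = S.Hw (u ++ [b]) z' := by
    rw [← e, ← hu _ hz, Hw_append]; rfl
  rcases S.Hw_parse hx hz' e2 with h1 | ⟨v, rfl, -⟩
  · exact absurd h1 (hw b)
  · have hm := (S.H_mem_Z_iff (S.Hw_mem v hy)).2 hb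
    exact ⟨_, hm, by rw [← hu _ hm, Hw_append, Hw_append]; rfl⟩

theorem same_piece_of_word {w : List (Fin n)}
    (hw : ∀ P : Piece n, S.Tch P.base → ∀ b, ¬ w <+: S.src P ++ [b])
    {P : Piece n} (hP : S.Tch P.base) {x y : ℝ} (hx : x ∈ S.T) (hy : y ∈ S.T)
    (h : ∃ z ∈ S.dom P, S.W (S.src P) z = S.Hw w x) :
    ∃ z ∈ S.dom P, S.W (S.src P) z = S.Hw w y := by
  obtain ⟨z, hz, e⟩ := h
  obtain ⟨z', hz', e'⟩ := S.all_or_nothing (fun _ h => S.Hw_src hP h) (hw P hP) hx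
    ⟨z, S.dom_subset hz, e⟩ hy
  cases P with
  | first i => exact ⟨z', hz', e'⟩
  | shift i k => exact ⟨z', hz', e'⟩
  | swap i k =>
    -- A shell is a copy of `Z` minus its inner copy, and the cylinder is not cut by either of them.
    refine ⟨z', ⟨hz', fun u hu hue => ?_⟩, e'⟩
    have hs : ∀ v, S.W (S.src (.shift i k)) v =
        S.W (S.src (.swap i k)) (S.W (List.replicate S.q S.l) v) := by
      intro v
      rw [← S.W_append, src, src, List.append_assoc]
    obtain ⟨v, hv, hve⟩ := S.all_or_nothing (u := S.src (.shift i k))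
      (fun _ h => S.Hw_src (P := .shift i k) hP h) (hw (.shift i k) hP) hy
      ⟨u, hu, by rw [hs, hue, e']⟩ hx
    rw [hs, ← e, S.W_inj] at hve
    exact hz.2 v hv hve

/-- Such a cylinder lies in a single piece or meets none, so `H j` is an exact similarity on it. -/
theorem H_Hw_sub {w : List (Fin n)}
    (hw : ∀ P : Piece n, S.Tch P.base → ∀ b, ¬ w <+: S.src P ++ [b]) (j : Fin n)
    {x y : ℝ} (hx : x ∈ S.T) (hy : y ∈ S.T) :
    S.H j (S.Hw w x) - S.H j (S.Hw w y) = S.ρ j * (S.Hw w x - S.Hw w y) := by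
  have key : ∀ {x y : ℝ}, x ∈ S.T → y ∈ S.T → (∃ v, S.Rew j (S.Hw w x) v) →
      S.H j (S.Hw w x) - S.H j (S.Hw w y) = S.ρ j * (S.Hw w x - S.Hw w y) := by
    rintro x y hx hy ⟨v, P, hP, rfl, z, hz, e, -⟩
    obtain ⟨z', hz', e'⟩ := S.same_piece_of_word hw hP hx hy ⟨z, hz, e⟩
    rw [← e, ← e']
    exact S.H_same_piece hP hz hz'
  by_cases h1 : ∃ v, S.Rew j (S.Hw w x) v
  · exact key hx hy h1
  by_cases h2 : ∃ v, S.Rew j (S.Hw w y) v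
  · linarith [key hy hx h2]
  · push Not at h1 h2
    rw [S.H_of_not h1, S.H_of_not h2, Ψ_sub]

/-- Only the run `o^{pk}` in the words of the pieces is unbounded. -/
theorem exists_length_bound : ∃ N, ∀ w : List (Fin n),
    (∃ P : Piece n, S.Tch P.base ∧ ∃ b, w <+: S.src P ++ [b]) →
      ∃ m v, w = List.replicate m S.o ++ v ∧ v.length ≤ N := by
  have : Nonempty (Fin n) := ⟨S.o⟩
  obtain ⟨i₀, hi₀⟩ := Finite.exists_max fun i => S.c i + (S.J i).length + S.q + 1
  refine ⟨S.c i₀ + (S.J i₀).length + S.q + 1, ?_⟩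
  have key : ∀ {w : List (Fin n)} (m : ℕ) {s : List (Fin n)}, w <+: List.replicate m S.o ++ s →
      ∃ m v, w = List.replicate m S.o ++ v ∧ v.length ≤ s.length := by
    intro w m s h
    rw [List.prefix_iff_eq_take, List.take_append, List.take_replicate] at h
    exact ⟨_, _, h, List.length_take_le' _ _⟩
  rintro w ⟨P, -, b, h⟩
  cases P with
  | first i =>
    refine ⟨0, w, rfl, h.length_le.trans ((le_trans ?_ (hi₀ i)))⟩
    simp only [src, List.length_append, List.length_replicate, List.length_singleton]
    omega
  | shift i k =>
    rw [src, List.append_assoc] at h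
    obtain ⟨m, v, hv, hl⟩ := key _ h
    refine ⟨m, v, hv, hl.trans ((le_trans ?_ (hi₀ i)))⟩
    simp only [List.length_append, List.length_replicate, List.length_singleton]
    omega
  | swap i k =>
    rw [src, List.append_assoc] at h
    obtain ⟨m, v, hv, hl⟩ := key _ h
    refine ⟨m, v, hv, hl.trans ((le_trans ?_ (hi₀ i)))⟩
    simp only [List.length_append, List.length_singleton]
    omega

variable {S} in
theorem BiLip.comp {K K' r r' : ℝ} {f g : ℝ → ℝ} (hK : 0 ≤ K) (hK' : 0 ≤ K') (hr : 0 ≤ r)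
    (hf : S.BiLip K r f) (hg : S.BiLip K' r' g) (hgT : ∀ x ∈ S.T, g x ∈ S.T) :
    S.BiLip (K * K') (r * r') (fun x => f (g x)) := by
  intro x hx y hy
  obtain ⟨h1, h2⟩ := hf _ (hgT x hx) _ (hgT y hy)
  obtain ⟨h3, h4⟩ := hg x hx y hy
  constructor
  · calc r * r' * |x - y| = r * (r' * |x - y|) := by ring
      _ ≤ r * (K' * |g x - g y|) := mul_le_mul_of_nonneg_left h3 hr
      _ = K' * (r * |g x - g y|) := by ring
      _ ≤ K' * (K * |f (g x) - f (g y)|) := mul_le_mul_of_nonneg_left h1 hK'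
      _ = _ := by ring
  · calc |f (g x) - f (g y)| ≤ K * (r * |g x - g y|) := h2
      _ ≤ K * (r * (K' * (r' * |x - y|))) := by gcongr
      _ = _ := by ring

variable {S} in
theorem BiLip.mono {K K' r : ℝ} {f : ℝ → ℝ} (hr : 0 ≤ r) (hf : S.BiLip K r f) (h : K ≤ K') :
    S.BiLip K' r f := by
  intro x hx y hy
  obtain ⟨h1, h2⟩ := hf x hx y hy
  exact ⟨h1.trans (by gcongr), h2.trans (by gcongr)⟩

theorem biLip_W (w : List (Fin n)) : S.BiLip 1 (S.R w) (S.W w) := by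
  intro x _ y _
  rw [W_sub, abs_mul, abs_of_pos (S.R_pos w), one_mul]
  exact ⟨le_rfl, le_rfl⟩

theorem biLip_Hw_pow {K : ℝ} (hK : 1 ≤ K) (h : ∀ j, S.BiLip K (S.ρ j) (S.H j))
    (w : List (Fin n)) : S.BiLip (K ^ w.length) (S.R w) (S.Hw w) := by
  induction w with
  | nil =>
    rw [List.length_nil, pow_zero]
    exact S.biLip_W []
  | cons j w ih =>
    rw [List.length_cons, pow_succ', R_cons]
    exact BiLip.comp (f := S.H j) (g := S.Hw w) (by positivity) (by positivity) (S.ρ_pos j).le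
      (h j) ih fun x hx => S.Hw_mem w hx

/-- The only source in the interval `o` lies in the image of `H l`, disjoint from that of `H o`. So
all letters `o` but the innermost act by `Ψ`. -/
theorem Hw_run_o (m : ℕ) (v : List (Fin n)) {x : ℝ} (hx : x ∈ S.T) :
    S.Hw (List.replicate (m + 1) S.o ++ v) x = S.W (List.replicate m S.o) (S.Hw (S.o :: v) x) := by
  induction m with
  | zero => rfl
  | succ m ih =>
    rw [List.replicate_succ, List.cons_append, Hw_cons, List.replicate_succ, W_cons, ← ih]
    refine S.H_eq_Ψ (fun h z hz e => ?_) fun i hi hs => absurd hs (S.suc_ne_o hi.1)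
    rw [← S.Hw_replicate_l _ hz] at e
    obtain ⟨r, hr⟩ := S.src_first h
    rw [hr] at e
    exact S.o_ne_l (S.H_injective (S.Hw_mem _ hz.1) (S.Hw_mem _ hx) e).1.symm

/-- The compositions of the maps of the rewired system are uniformly bi-Lipschitz. -/
theorem exists_biLip_Hw : ∃ K, 1 ≤ K ∧ (∀ j, S.BiLip K (S.ρ j) (S.H j)) ∧
    ∀ w, S.BiLip K (S.R w) (S.Hw w) := by
  obtain ⟨K, hK, hH⟩ := S.exists_biLip_H
  obtain ⟨N, hN⟩ := S.exists_length_bound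
  have hC : 1 ≤ K ^ (N + 2) := one_le_pow₀ hK
  have hle : ∀ m, m ≤ N + 2 → K ^ m ≤ K ^ (N + 2) := fun m hm => pow_le_pow_right₀ hK hm
  refine ⟨K ^ (N + 2), hC, fun j => (hH j).mono (S.ρ_pos j).le ?_, fun w => ?_⟩
  · simpa using hle 1 (by omega)
  · induction w with
    | nil => exact BiLip.mono (f := S.Hw []) (S.R_pos []).le (S.biLip_W []) hC
    | cons j w ih =>
      -- For exceptional `w` the run of `o` costs nothing, leaving at most `N + 2` factors `K`
      -- counted afresh; for all other `w` the letter `j` keeps the inductive constant.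
      by_cases hw : ∃ P : Piece n, S.Tch P.base ∧ ∃ b, w <+: S.src P ++ [b]
      · obtain ⟨m, v, hwv, hv⟩ := hN w hw
        cases m with
        | zero =>
          have e : w = v := by simpa using hwv
          rw [e]
          refine (S.biLip_Hw_pow hK hH (j :: v)).mono (S.R_pos _).le (hle _ ?_)
          rw [List.length_cons]; omega
        | succ m =>
          have h1 := S.biLip_Hw_pow hK hH (S.o :: v)
          have h2 := BiLip.comp zero_le_one (by positivity) (S.R_pos _).le
            (S.biLip_W (List.replicate m S.o)) h1 fun x hx => S.Hw_mem _ hx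
          have h3 := BiLip.comp (by positivity) (by positivity) (S.ρ_pos j).le (hH j) h2
            fun x hx => S.W_mem _ (S.Hw_mem _ hx)
          rw [one_mul, ← pow_succ'] at h3
          have h4 := h3.mono (mul_pos (S.ρ_pos j) (mul_pos (S.R_pos _) (S.R_pos _))).le
            (hle _ (by rw [List.length_cons]; omega))
          have e : S.R (j :: w) = S.ρ j * (S.R (List.replicate m S.o) * S.R (S.o :: v)) := by
            rw [hwv, R_cons, R_cons, R_append, R_replicate, R_replicate, pow_succ]; ring
          rw [e]
          intro x hx y hy
          rw [hwv, Hw_cons, Hw_cons, S.Hw_run_o m v hx, S.Hw_run_o m v hy]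
          exact h4 x hx y hy
      · push Not at hw
        intro x hx y hy
        obtain ⟨h1, h2⟩ := ih x hx y hy
        rw [Hw_cons, Hw_cons, S.H_Hw_sub hw j hx hy, abs_mul, abs_of_pos (S.ρ_pos j), R_cons]
        have h3 := mul_le_mul_of_nonneg_left h1 (S.ρ_pos j).le
        have h4 := mul_le_mul_of_nonneg_left h2 (S.ρ_pos j).le
        constructor <;> linarith

theorem generatesAtScale : ∃ c C, 0 < c ∧ 0 < C ∧ GeneratesAtScale S.ρ S.T S.H c C := by
  obtain ⟨K, hK, hH, hHw⟩ := S.exists_biLip_Hw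
  have hK0 : 0 < K := by linarith
  have hcont : ∀ j, IsCompact (S.H j '' S.T) := by
    intro j
    refine S.attractor.2.1.image_of_continuousOn (LipschitzOnWith.continuousOn
      (K := (K * S.ρ j).toNNReal) (LipschitzOnWith.of_dist_le_mul fun x hx y hy => ?_))
    rw [Real.dist_eq, Real.dist_eq, Real.coe_toNNReal _ (mul_pos hK0 (S.ρ_pos j)).le, mul_assoc]
    exact (hH j x hx y hy).2
  obtain ⟨c, hc, hsep⟩ := exists_separation hcont fun i j hij => Set.disjoint_left.2 (by
    rintro _ ⟨x, hx, rfl⟩ ⟨y, hy, e⟩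
    exact hij (S.H_injective hx hy e.symm).1)
  -- First-level images are disjoint compact sets at distance at least `c`; composing with a
  -- cylinder map loses a factor `K`.
  refine ⟨c / K, K, by positivity, hK0, S.attractor.2.1, S.attractor.1,
    fun _ _ hx => S.H_mem hx, fun _ hx => S.H_surjective hx, ?_, ?_⟩
  · intro w x hx y hy
    refine (hHw w x hx y hy).2.trans (mul_le_mul_of_nonneg_left ?_ hK0.le)
    have h1 := S.nonneg hx
    have h2 := S.nonneg hy
    have h3 := S.le_one hx
    have h4 := S.le_one hy
    exact mul_le_of_le_one_right (S.R_pos w).le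
      (abs_sub_le_iff.2 ⟨by linarith, by linarith⟩)
  · intro w i j hij x hx y hy
    have h1 := (hHw w _ (S.H_mem (j := i) hx) _ (S.H_mem (j := j) hy)).1
    have h2 := mul_le_mul_of_nonneg_left
      (hsep i j hij _ ⟨x, hx, rfl⟩ _ ⟨y, hy, rfl⟩) (S.R_pos w).le
    rw [div_mul_eq_mul_div, div_le_iff₀ hK0, mul_comm c, mul_comm _ K]
    exact h2.trans h1

end TouchSystem

/-! ### From rational logarithm ratios to exponents, and the first case -/

theorem exists_pow_eq_of_log_ratio {x y : ℝ} (hx : 0 < x) (hx1 : x < 1) (hy : 0 < y) (hy1 : y < 1)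
    (h : ∃ r : ℚ, Real.log x / Real.log y = r) : ∃ p q : ℕ, 0 < p ∧ 0 < q ∧ x ^ p = y ^ q := by
  obtain ⟨r, hr⟩ := h
  have hlx := Real.log_neg hx hx1
  have hly := Real.log_neg hy hy1
  have hr0 : 0 < r := by
    have : (0 : ℝ) < r := hr ▸ div_pos_of_neg_of_neg hlx hly
    exact_mod_cast this
  have hnum : 0 < r.num := Rat.num_pos.2 hr0
  have hn : ((r.num.toNat : ℕ) : ℤ) = r.num := Int.toNat_of_nonneg hnum.le
  refine ⟨r.den, r.num.toNat, r.den_pos, by omega, ?_⟩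
  refine Real.log_injOn_pos (pow_pos hx _) (pow_pos hy _) ?_
  rw [Real.log_pow, Real.log_pow]
  have h1 : Real.log x = r * Real.log y := by rw [← hr, div_mul_cancel₀ _ hly.ne]
  have h2 : (r.den : ℝ) * r = ((r.num.toNat : ℕ) : ℝ) := by
    have h3 : (r.den : ℚ) * r = r.num := Rat.den_mul_eq_num r
    have h4 : (r.den : ℝ) * r = (r.num : ℝ) := by exact_mod_cast h3
    rw [h4]; exact_mod_cast hn.symm
  rw [h1, ← mul_assoc, h2]

section Touching

variable {n : ℕ} {ρ t : Fin n → ℝ}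

theorem mem_touchingLetters {i j : Fin n} (hij : (j : ℕ) = i + 1)
    (h : affineIFS ρ t i 1 = affineIFS ρ t j 0) : letter i ∈ touchingLetters ρ t :=
  ⟨i, j, rfl, by simp [letter, hij], h⟩

/-- Some interval is followed by a gap, since the lengths of the intervals add up to less than
`1`. -/
theorem exists_gap (hρ : IsContractionVector ρ) (hΨ : IsTouchingIFS ρ t) (hn : 0 < n) :
    ∃ m, ∃ h : m + 1 < n,
      affineIFS ρ t ⟨m, (Nat.lt_succ_self m).trans h⟩ 1 ≠ affineIFS ρ t ⟨m + 1, h⟩ 0 := by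
  by_contra hcon
  push Not at hcon
  let f : ℕ → ℝ := fun k => if h : k < n then ρ ⟨k, h⟩ else 0
  -- Without gaps the right ends are the partial sums of the ratios, and the last one would be `1`.
  have key : ∀ m (h : m < n), affineIFS ρ t ⟨m, h⟩ 1 = ∑ k ∈ Finset.range (m + 1), f k := by
    intro m
    induction m with
    | zero =>
      intro h
      have := hΨ.left_end ⟨0, h⟩ rfl
      simp only [affineIFS, f] at *
      simp [h] at *
      linarith
    | succ m ih =>
      intro h
      have h1 := ih ((Nat.lt_succ_self m).trans h)
      have h2 := hcon m h
      rw [Finset.sum_range_succ, ← h1, h2]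
      simp only [affineIFS, f, dif_pos h]
      ring
  obtain ⟨m, rfl⟩ := Nat.exists_eq_succ_of_ne_zero hn.ne'
  have h1 := key m (Nat.lt_succ_self m)
  rw [hΨ.right_end ⟨m, Nat.lt_succ_self m⟩ rfl, Finset.sum_range] at h1
  have h2 := hρ.2
  have h3 : ∑ i : Fin (m + 1), f i = ∑ i, ρ i := Finset.sum_congr rfl fun i _ => dif_pos i.isLt
  rw [h3] at h1
  exact absurd h1 h2.ne'

theorem lipschitzEquivalent_of_right_letters (hρ : IsContractionVector ρ) (hΨ : IsTouchingIFS ρ t)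
    {D T : Set ℝ} (hD : IsDustLike ρ D) (hT : IsAttractor (affineIFS ρ t) T)
    (h : RationalLogRatios ρ ({1, n} ∪ (fun k => k + 1) '' touchingLetters ρ t)) :
    LipschitzEquivalent D T := by
  classical
  have hn : 0 < n := by
    obtain ⟨k, i, -⟩ := hΨ.touching
    exact i.pos
  have hgap := exists_gap hρ hΨ hn
  obtain ⟨hm, hne⟩ := Nat.find_spec hgap
  have hmin := fun m => Nat.find_min hgap (m := m)
  generalize Nat.find hgap = m at hm hne hmin
  let o : Fin n := ⟨0, hn⟩
  let l : Fin n := ⟨n - 1, by omega⟩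
  let a : Fin n := ⟨m, (Nat.lt_succ_self m).trans hm⟩
  let suc : Fin n → Fin n := fun i => if h : (i : ℕ) + 1 < n then ⟨i + 1, h⟩ else i
  have suc_val : ∀ i, i ≠ l → (suc i : ℕ) = i + 1 := by
    intro i hi
    have h1 : (i : ℕ) + 1 < n := by
      by_contra hc
      exact hi (Fin.ext (by simp only [l]; omega))
    simp only [suc, dif_pos h1]
  have hal : a ≠ l := fun h => by
    have := congrArg Fin.val h
    simp only [a, l] at this
    omega
  have hsa : suc a = ⟨m + 1, hm⟩ := Fin.ext (suc_val a hal)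
  have hrat : ∀ {i j : Fin n}, letter i ∈ ({1, n} ∪ (fun k => k + 1) '' touchingLetters ρ t : Set ℕ)
      → letter j ∈ ({1, n} ∪ (fun k => k + 1) '' touchingLetters ρ t : Set ℕ) →
      ∃ r : ℚ, Real.log (ρ i) / Real.log (ρ j) = r := fun hi hj => h _ _ hi hj
  have ho : letter o ∈ ({1, n} ∪ (fun k => k + 1) '' touchingLetters ρ t : Set ℕ) :=
    Or.inl (Or.inl rfl)
  have hl : letter l ∈ ({1, n} ∪ (fun k => k + 1) '' touchingLetters ρ t : Set ℕ) :=
    Or.inl (Or.inr (show n - 1 + 1 = n by omega))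
  have hs : ∀ {i j : Fin n}, (j : ℕ) = i + 1 → affineIFS ρ t i 1 = affineIFS ρ t j 0 →
      letter j ∈ ({1, n} ∪ (fun k => k + 1) '' touchingLetters ρ t : Set ℕ) := fun {i j} hij hij' =>
    Or.inr ⟨letter i, mem_touchingLetters hij hij', by simp [letter, hij]⟩
  -- All intervals before the first gap touch, so `a` is the first letter or follows a touching
  -- letter.
  have ha : letter a ∈ ({1, n} ∪ (fun k => k + 1) '' touchingLetters ρ t : Set ℕ) := by
    rcases Nat.eq_zero_or_pos m with h0 | h0
    · exact Or.inl (Or.inl (show m + 1 = 1 by omega))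
    · obtain ⟨m', rfl⟩ := Nat.exists_eq_succ_of_ne_zero h0.ne'
      have h1 := hmin m' (Nat.lt_succ_self m')
      push Not at h1
      exact hs (i := ⟨m', by omega⟩) rfl (h1 (by omega))
  obtain ⟨p, q, hp, hq, hpq⟩ := exists_pow_eq_of_log_ratio (hρ.1 o).1 (hρ.1 o).2 (hρ.1 l).1
    (hρ.1 l).2 (hrat ho hl)
  have hdc : ∀ i, ∃ d c : ℕ, i ≠ l → affineIFS ρ t i 1 = affineIFS ρ t (suc i) 0 →
      0 < d ∧ d < c ∧ ρ (suc i) ^ d * ρ o ^ d * ρ a ^ d * ρ l ^ d = ρ l ^ c := by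
    intro i
    by_cases hi : i ≠ l ∧ affineIFS ρ t i 1 = affineIFS ρ t (suc i) 0
    · have hsi := hs (suc_val i hi.1) hi.2
      obtain ⟨⟨a0, a1⟩, ⟨b0, b1⟩, ⟨c0, c1⟩, ⟨d0, d1⟩⟩ :=
        And.intro (hρ.1 (suc i)) (And.intro (hρ.1 o) (And.intro (hρ.1 a) (hρ.1 l)))
      have hlt : ρ (suc i) * ρ o * ρ a < 1 := by
        have h1 : ρ (suc i) * ρ o < 1 := mul_lt_one_of_nonneg_of_lt_one_left a0.le a1 b1.le
        exact mul_lt_one_of_nonneg_of_lt_one_left (by positivity) h1 c1.le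
      -- This strict inequality is what forces `d < c` in the relation `(ρ_{suc i} ρ_o ρ_a ρ_l)^d =
      -- ρ_l^c`.
      have hlt' : ρ (suc i) * ρ o * ρ a * ρ l < ρ l := mul_lt_of_lt_one_left d0 hlt
      have hx0 : 0 < ρ (suc i) * ρ o * ρ a * ρ l := by positivity
      have hQ : ∃ r : ℚ, Real.log (ρ (suc i) * ρ o * ρ a * ρ l) / Real.log (ρ l) = r := by
        obtain ⟨r1, e1⟩ := hrat hsi hl
        obtain ⟨r2, e2⟩ := hrat ho hl
        obtain ⟨r3, e3⟩ := hrat ha hl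
        refine ⟨r1 + r2 + r3 + 1, ?_⟩
        rw [Real.log_mul (by positivity) d0.ne', Real.log_mul (by positivity) c0.ne',
          Real.log_mul a0.ne' b0.ne', add_div, add_div, add_div, e1, e2, e3,
          div_self (Real.log_neg d0 d1).ne]
        push_cast
        rfl
      obtain ⟨d, c, hd, -, hdc⟩ := exists_pow_eq_of_log_ratio hx0 (hlt'.trans d1) d0 d1 hQ
      refine ⟨d, c, fun _ _ => ⟨hd, ?_, ?_⟩⟩
      · by_contra hcd
        have h1 := pow_lt_pow_left₀ hlt' hx0.le hd.ne'
        have h2 := pow_le_pow_of_le_one d0.le d1.le (not_lt.1 hcd)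
        linarith
      · rw [← hdc, mul_pow, mul_pow, mul_pow]
    · exact ⟨0, 0, fun h1 h2 => absurd ⟨h1, h2⟩ hi⟩
  choose d c hdc using hdc
  let S : TouchSystem n :=
    { ρ := ρ, t := t, T := T, ρ_pos := fun i => (hρ.1 i).1, ρ_lt := fun i => (hρ.1 i).2
      ordered := hΨ.ordered, o := o, l := l, a := a, suc := suc, o_val := rfl
      l_val := show n - 1 + 1 = n by omega
      suc_val := suc_val
      left_end := hΨ.left_end o rfl
      right_end := hΨ.right_end l (show n - 1 + 1 = n by omega)
      attractor := hT, a_ne := hal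
      gap := by
        rw [hsa]
        exact lt_of_le_of_ne (hΨ.ordered _ _ (Fin.mk_lt_mk.2 (Nat.lt_succ_self m))) hne
      p := p, q := q, p_pos := hp, q_pos := hq, pow_eq := hpq, d := d, c := c
      d_pos := fun i h1 h2 => (hdc i h1 h2).1
      d_lt_c := fun i h1 h2 => (hdc i h1 h2).2.1
      ratio := fun i h1 h2 => (hdc i h1 h2).2.2 }
  obtain ⟨Φ, c₁, C₁, hc₁, hC₁, hDG⟩ := hD.generatesAtScale fun i => (hρ.1 i).1
  obtain ⟨c₂, C₂, hc₂, hC₂, hTG⟩ := S.generatesAtScale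
  exact GeneratesAtScale.lipschitzEquivalent (fun i => (hρ.1 i).1) (fun i => (hρ.1 i).2) hDG hTG
    hc₁ hC₁ hc₂ hC₂

end Touching

/-! ### Reflection and the second case -/

section Reflection

variable {n : ℕ} {ρ t : Fin n → ℝ}

/-- The translation parts of the system reflected at `1 / 2`. -/
def reflectedShift (ρ t : Fin n → ℝ) (i : Fin n) : ℝ := 1 - ρ i.rev - t i.rev

theorem affineIFS_reflected (i : Fin n) (x : ℝ) :
    affineIFS (ρ ∘ Fin.rev) (reflectedShift ρ t) i x = 1 - affineIFS ρ t i.rev (1 - x) := by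
  simp only [affineIFS, reflectedShift, Function.comp]; ring

theorem letter_rev (i : Fin n) : letter i.rev + letter i = n + 1 := by
  have := i.isLt
  simp only [letter, Fin.val_rev]
  omega

theorem touch_reflected {i j : Fin n} :
    affineIFS (ρ ∘ Fin.rev) (reflectedShift ρ t) i 1 =
      affineIFS (ρ ∘ Fin.rev) (reflectedShift ρ t) j 0 ↔
    affineIFS ρ t j.rev 1 = affineIFS ρ t i.rev 0 := by
  rw [affineIFS_reflected, affineIFS_reflected, sub_self, sub_zero, sub_right_inj, eq_comm]

theorem IsContractionVector.reflected (h : IsContractionVector ρ) :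
    IsContractionVector (ρ ∘ Fin.rev) :=
  ⟨fun _ => h.1 _, (Equiv.sum_comp Fin.revPerm ρ).trans_lt h.2⟩

theorem IsDustLike.reflected {D : Set ℝ} (h : IsDustLike ρ D) : IsDustLike (ρ ∘ Fin.rev) D := by
  obtain ⟨Φ, h1, ⟨h2, h3, h4⟩, h5⟩ := h
  refine ⟨Φ ∘ Fin.rev, fun _ => h1 _, ⟨h2, h3, ?_⟩, fun i j hij => h5 _ _ ?_⟩
  · conv_rhs => rw [← h4]
    exact Equiv.iSup_comp (g := fun i => Φ i '' D) Fin.revPerm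
  · exact fun h => hij (Fin.rev_injective h)

theorem IsTouchingIFS.reflected (h : IsTouchingIFS ρ t) :
    IsTouchingIFS (ρ ∘ Fin.rev) (reflectedShift ρ t) where
  ordered i j hij := by
    rw [affineIFS_reflected, affineIFS_reflected, sub_self, sub_zero]
    have := h.ordered j.rev i.rev (Fin.rev_lt_rev.2 hij)
    linarith
  left_end i hi := by
    have h1 := letter_rev i
    rw [affineIFS_reflected, sub_zero, h.right_end i.rev (by omega), sub_self]
  right_end i hi := by
    have h1 := letter_rev i
    rw [affineIFS_reflected, sub_self, h.left_end i.rev (by omega), sub_zero]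
  touching := by
    obtain ⟨k, i, j, hi, hj, hij⟩ := h.touching
    have h1 := letter_rev i
    have h2 := letter_rev j
    refine ⟨letter j.rev, j.rev, i.rev, rfl, by omega, ?_⟩
    rw [touch_reflected, Fin.rev_rev, Fin.rev_rev]
    exact hij

theorem IsAttractor.reflected {T : Set ℝ} (h : IsAttractor (affineIFS ρ t) T) :
    IsAttractor (affineIFS (ρ ∘ Fin.rev) (reflectedShift ρ t)) ((fun x => 1 - x) '' T) := by
  obtain ⟨h1, h2, h3⟩ := h
  refine ⟨h1.image _, h2.image (by fun_prop), ?_⟩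
  ext x
  simp only [Set.mem_iUnion, Set.mem_image]
  constructor
  · rintro ⟨i, _, ⟨y, hy, rfl⟩, rfl⟩
    refine ⟨affineIFS ρ t i.rev y, ?_, by rw [affineIFS_reflected, sub_sub_cancel]⟩
    rw [← h3]
    exact Set.mem_iUnion.2 ⟨_, y, hy, rfl⟩
  · rintro ⟨y, hy, rfl⟩
    rw [← h3] at hy
    obtain ⟨i, z, hz, rfl⟩ := Set.mem_iUnion.1 hy
    exact ⟨i.rev, _, ⟨z, hz, rfl⟩, by rw [affineIFS_reflected, sub_sub_cancel, Fin.rev_rev]⟩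

theorem LipschitzEquivalent.of_reflected {D T : Set ℝ}
    (h : LipschitzEquivalent D ((fun x => 1 - x) '' T)) : LipschitzEquivalent D T := by
  obtain ⟨f, ⟨hinj, hsurj⟩, c, c', hc, hc', hf⟩ := h
  have hmem : ∀ x, 1 - (f x : ℝ) ∈ T := by
    intro x
    obtain ⟨y, hy, e⟩ := (f x).2
    rw [← e]
    simpa using hy
  refine ⟨fun x => ⟨1 - f x, hmem x⟩, ⟨fun x y hxy => hinj (Subtype.ext ?_), ?_⟩, c, c', hc, hc', ?_⟩
  · have := congrArg Subtype.val hxy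
    simpa using this
  · rintro ⟨y, hy⟩
    obtain ⟨x, hx⟩ := hsurj ⟨1 - y, y, hy, rfl⟩
    exact ⟨x, Subtype.ext (by simp [hx])⟩
  · intro x y
    have e : dist (⟨1 - f x, hmem x⟩ : T) ⟨1 - f y, hmem y⟩ = dist (f x) (f y) := by
      rw [Subtype.dist_eq, Subtype.dist_eq]
      exact dist_sub_left _ _ _
    rw [e]
    exact hf x y

/-- Reflection reverses each touching pair, so successors of touching letters of the reflected
system correspond to touching letters of the original one, and `1` and `n` are exchanged. -/
theorem lipschitzEquivalent_of_left_letters (hρ : IsContractionVector ρ) (hΨ : IsTouchingIFS ρ t)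
    {D T : Set ℝ} (hD : IsDustLike ρ D) (hT : IsAttractor (affineIFS ρ t) T)
    (h : RationalLogRatios ρ ({1, n} ∪ touchingLetters ρ t)) : LipschitzEquivalent D T := by
  refine LipschitzEquivalent.of_reflected (lipschitzEquivalent_of_right_letters hρ.reflected
    hΨ.reflected hD.reflected hT.reflected ?_)
  have key : ∀ i : Fin n, letter i ∈ ({1, n} ∪ (fun k => k + 1) ''
      touchingLetters (ρ ∘ Fin.rev) (reflectedShift ρ t) : Set ℕ) →
      letter i.rev ∈ ({1, n} ∪ touchingLetters ρ t : Set ℕ) := by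
    intro i hi
    have h1 := letter_rev i
    rcases hi with (hi | hi) | ⟨k, ⟨i', j', hi', hj', e⟩, hk⟩
    · exact Or.inl (Or.inr (show letter i.rev = n by rw [hi] at h1; omega))
    · have hi : letter i = n := hi
      exact Or.inl (Or.inl (show letter i.rev = 1 by omega))
    · have h2 := letter_rev i'
      have hk : k + 1 = letter i := hk
      have hji : j' = i := by
        simp only [letter] at *
        exact Fin.ext (by omega)
      subst hji
      exact Or.inr ⟨j'.rev, i'.rev, rfl, by omega, touch_reflected.1 e⟩
  exact fun i j hi hj => h _ _ (key i hi) (key j hj)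

end Reflection

theorem corollary1p3 (n : ℕ) (hn : 3 ≤ n) (ρ t : Fin n → ℝ)
    (hρ : IsContractionVector ρ) (hΨ : IsTouchingIFS ρ t)
    (D T : Set ℝ) (hD : IsDustLike ρ D) (hT : IsAttractor (affineIFS ρ t) T)
    (h : RationalLogRatios ρ
          ({1, n, alphaT ρ t} ∪ (fun k => k + 1) '' touchingLetters ρ t) ∨
        RationalLogRatios ρ
          ({1, n, n - betaT ρ t + 1} ∪ touchingLetters ρ t)) :
    LipschitzEquivalent D T := by
  have hsub : ∀ (m : ℕ) (A : Set ℕ), ({1, n} ∪ A : Set ℕ) ⊆ {1, n, m} ∪ A := by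
    intro m A
    refine Set.union_subset_union_left _ ?_
    rintro x (rfl | rfl)
    · exact Or.inl rfl
    · exact Or.inr (Or.inl rfl)
  rcases h with h | h
  · exact lipschitzEquivalent_of_right_letters hρ hΨ hD hT
      fun i j hi hj => h i j (hsub _ _ hi) (hsub _ _ hj)
  · exact lipschitzEquivalent_of_left_letters hρ hΨ hD hT
      fun i j hi hj => h i j (hsub _ _ hi) (hsub _ _ hj)
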